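/- Let $n\ge 2$, let $S^{2n-1}\subset\mathbb{C}^n$ be the unit sphere, $J$ multiplication by $i$, $JN$ the vector field $JN(u)=Ju$ on $S^{2n-1}$, $\Delta$ the Laplace--Beltrami operator of the round metric, and $\omega_m$ the volume of the $m$-dimensional euclidean unit ball. For $c_0,c_1\in\mathbb{R}$ define operators $C^2(S^{2n-1})\to C(S^{2n-1})$ by $$D_\mu f=\frac{1}{\omega_{2n-2}}\Big[2n(c_1-c_0)\,JN(JNf)+(2c_0-c_1)\,\Delta f+(2(n-1)c_0+c_1)f\Big]$$ (attached to the unitary valuation $\mu=c_0\mu_{2,0}+c_1\mu_{2,1}$ of degree $2$) and, for $n\ge 3$, $$D_{\mu,B} f=\frac{1}{\omega_{2n-3}}\Big[(a-b)\,JN(JNf)+b\,\Delta f+(a+2(n-1)b)f\Big],$$ $$a=(n-1)\big((2n-3)c_1-2(n-2)c_0\big),\qquad b=2(n-2)c_0-(n-3)c_1$$ (attached to $\mu=c_0\mu_{3,0}+c_1\mu_{3,1}$ of degree $3$ and the unit ball $B$). For an operator $D$ as above let $D^{\mathbb{C}}$ be its complex-linear extension to complex-valued $C^2$ functions. Let $\mathcal{H}_{k,l}$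 be the space of restrictions to $S^{2n-1}$ of harmonic polynomials $P\in\mathbb{C}[x_1,y_1,\dots,x_n,y_n]$ (where $z_j=x_j+iy_j$) such that $P(\lambda z)=\lambda^k\overline{\lambda}^{\,l}P(z)$ for all $\lambda\in\mathbb{C}$ and $z\in\mathbb{C}^n$. Then: 1. If $D=D_\mu$ and $2(n-1)c_0\le(2n-1)c_1$ and $(4n+1)c_1<2(3n+1)c_0$, then $D^{\mathbb{C}}$ has precisely one positive eigenvalue, whose eigenspace is the $1$-dimensional space of constant functions, and the kernel of $D^{\mathbb{C}}$ consists precisely of the restrictions to $S^{2n-1}$ of the complex-valued $\mathbb{R}$-linear functionals on $\mathbb{C}^n$. 2. If $n\ge 3$, $D=D_{\mu,B}$ and $2(n-2)c_0\le(2n-3)c_1$ and $(4n^2-9n-3)c_1<2(3n^2-5n-2)c_0$, then the same two conclusions hold for $D^{\mathbb{C}}$. 3. If $D=D_\mu$ and $0<(4n+1)c_1=2(3n+1)c_0$, then the kernel of $D^{\mathbb{C}}$ is $\mathcal{H}_{1,0}\oplus\mathcal{H}_{0,1}\oplus\mathcal{H}_{1,1}$ (in particular this sum is direct). -/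

import Mathlib

open scoped Manifold ContDiff

noncomputable section

namespace UnitaryVal

/-- `ℂⁿ`, with its standard hermitian and euclidean structures. -/
abbrev Cn (n : ℕ) : Type := EuclideanSpace ℂ (Fin n)

/-- The unit sphere `S^{2n-1}` of `ℂⁿ`. -/
abbrev Sph (n : ℕ) : Type := Metric.sphere (0 : Cn n) 1

/-- For `n ≥ 1` the real dimension of `ℂⁿ` is `(2n-1)+1`; through this fact `S^{2n-1}` carries
Mathlib's structure of a smooth manifold of dimension `2n-1`. -/
instance finrank_Cn (n : ℕ) [NeZero n] :
    Fact (Module.finrank ℝ (Cn n) = (2 * n - 1) + 1) := by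
  constructor
  have h : Module.finrank ℝ (Cn n) = 2 * n := by
    rw [← Module.finrank_mul_finrank ℝ ℂ (Cn n), Complex.finrank_real_complex,
      finrank_euclideanSpace_fin]
  have := NeZero.pos n
  omega

/-- `f : S^{2n-1} → F` is of class `C²` on the manifold `S^{2n-1}`. -/
def IsC2 {n : ℕ} [NeZero n] {F : Type*} [NormedAddCommGroup F] [NormedSpace ℝ F]
    (f : Sph n → F) : Prop :=
  ContMDiff (𝓡 (2 * n - 1)) 𝓘(ℝ, F) 2 f

/-- The rotation `u ↦ e^{it} u = cos t u + sin t Ju` of the sphere. -/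
def rot {n : ℕ} (t : ℝ) (u : Sph n) : Sph n :=
  ⟨Complex.exp (t * Complex.I) • (u : Cn n), by
    rw [mem_sphere_zero_iff_norm, norm_smul, Complex.norm_exp_ofReal_mul_I, norm_eq_of_mem_sphere,
      one_mul]⟩

/-- The derivative of `f` along the vector field `JN(u) = Ju`, computed along the integral curve
`t ↦ e^{it} u` of `JN` through `u`. -/
def JN {n : ℕ} (f : Sph n → ℝ) (u : Sph n) : ℝ :=
  deriv (fun t : ℝ => f (rot t u)) 0

/-- The extension `x ↦ f (x / |x|)` of `f` to `ℂⁿ ∖ {0}`, constant along rays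
(and set to `0` at the origin). -/
def radialExt {n : ℕ} (f : Sph n → ℝ) (x : Cn n) : ℝ :=
  if h : x = 0 then 0
  else f ⟨‖x‖⁻¹ • x, by
    rw [mem_sphere_zero_iff_norm, norm_smul, norm_inv, norm_norm,
      inv_mul_cancel₀ (norm_ne_zero_iff.mpr h)]⟩

/-- The Laplace-Beltrami operator of the round sphere `S^{2n-1}`: the euclidean Laplacian (on
`ℂⁿ = ℝ²ⁿ`) of the extension of `f` that is constant along rays, restricted to the sphere. -/
def sphLaplacian {n : ℕ} (f : Sph n → ℝ) (u : Sph n) : ℝ :=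
  Laplacian.laplacian (radialExt f) (u : Cn n)

/-- `ω_m`, the volume of the euclidean unit ball of `ℝᵐ`. -/
def ballVol (m : ℕ) : ℝ :=
  (MeasureTheory.volume (Metric.ball (0 : EuclideanSpace ℝ (Fin m)) 1)).toReal

/-- The operator `D_μ` for `μ = c₀ μ_{2,0} + c₁ μ_{2,1}`. -/
def opTwo (n : ℕ) (c₀ c₁ : ℝ) (f : Sph n → ℝ) (u : Sph n) : ℝ :=
  1 / ballVol (2 * n - 2) *
    (2 * n * (c₁ - c₀) * JN (JN f) u + (2 * c₀ - c₁) * sphLaplacian f u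
      + (2 * ((n : ℝ) - 1) * c₀ + c₁) * f u)

/-- The coefficient `a` of `D_{μ,B}`. -/
def coeffA (n : ℕ) (c₀ c₁ : ℝ) : ℝ :=
  ((n : ℝ) - 1) * ((2 * (n : ℝ) - 3) * c₁ - 2 * ((n : ℝ) - 2) * c₀)

/-- The coefficient `b` of `D_{μ,B}`. -/
def coeffB (n : ℕ) (c₀ c₁ : ℝ) : ℝ :=
  2 * ((n : ℝ) - 2) * c₀ - ((n : ℝ) - 3) * c₁

/-- The operator `D_{μ,B}` for `μ = c₀ μ_{3,0} + c₁ μ_{3,1}` and `B` the unit ball. -/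
def opThreeBall (n : ℕ) (c₀ c₁ : ℝ) (f : Sph n → ℝ) (u : Sph n) : ℝ :=
  1 / ballVol (2 * n - 3) *
    ((coeffA n c₀ c₁ - coeffB n c₀ c₁) * JN (JN f) u + coeffB n c₀ c₁ * sphLaplacian f u
      + (coeffA n c₀ c₁ + 2 * ((n : ℝ) - 1) * coeffB n c₀ c₁) * f u)

/-- The extension `D^ℂ (g + i h) = D g + i D h` of `D` to complex-valued functions. -/
def complexify {n : ℕ} (D : (Sph n → ℝ) → Sph n → ℝ) (f : Sph n → ℂ) (u : Sph n) : ℂ :=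
  (D (fun v => (f v).re) u : ℂ) + Complex.I * (D (fun v => (f v).im) u : ℂ)

/-- The set of `f ∈ C²(S^{2n-1}, ℂ)` with `T f = z f`. For `z = 0` this is the kernel of `T`. -/
def eigenfunctions {n : ℕ} [NeZero n] (T : (Sph n → ℂ) → Sph n → ℂ) (z : ℂ) :
    Set (Sph n → ℂ) :=
  {f | IsC2 f ∧ ∀ u, T f u = z * f u}

/-- `z` is an eigenvalue of `T` on `C²(S^{2n-1}, ℂ)`. -/
def IsEigenvalue {n : ℕ} [NeZero n] (T : (Sph n → ℂ) → Sph n → ℂ) (z : ℂ) : Prop :=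
  ∃ f ∈ eigenfunctions T z, f ≠ 0

/-- The constant complex-valued functions on the sphere. -/
def constants (n : ℕ) : Set (Sph n → ℂ) :=
  {f | ∃ z : ℂ, ∀ u, f u = z}

/-- The restrictions to the sphere of the (complex-valued, real-linear) linear functionals. -/
def linearFunctionals (n : ℕ) : Set (Sph n → ℂ) :=
  {f | ∃ L : Cn n →ₗ[ℝ] ℂ, ∀ u : Sph n, f u = L (u : Cn n)}

/-- The value at `z ∈ ℂⁿ` of a polynomial `P ∈ ℂ[x₁, y₁, …, xₙ, yₙ]`, where `z_j = x_j + i y_j`;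
`Sum.inl j` stands for the variable `x_j` and `Sum.inr j` for `y_j`. -/
def polyVal {n : ℕ} (P : MvPolynomial (Fin n ⊕ Fin n) ℂ) (z : Cn n) : ℂ :=
  MvPolynomial.eval (Sum.elim (fun j => ((z j).re : ℂ)) (fun j => ((z j).im : ℂ))) P

/-- `P` is harmonic: the sum of its second partial derivatives is zero. -/
def IsHarmonicPoly {n : ℕ} (P : MvPolynomial (Fin n ⊕ Fin n) ℂ) : Prop :=
  ∑ s, MvPolynomial.pderiv s (MvPolynomial.pderiv s P) = 0

/-- The space `H_{k,l}` of spherical harmonics of bi-degree `(k,l)`. -/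
def harm (n k l : ℕ) : Submodule ℂ (Sph n → ℂ) where
  carrier := {f | ∃ P : MvPolynomial (Fin n ⊕ Fin n) ℂ, IsHarmonicPoly P ∧
    (∀ (w : ℂ) (z : Cn n), polyVal P (w • z) = w ^ k * (starRingEnd ℂ w) ^ l * polyVal P z) ∧
    ∀ u : Sph n, f u = polyVal P (u : Cn n)}
  zero_mem' := ⟨0, by simp [IsHarmonicPoly], by simp [polyVal], by simp [polyVal]⟩
  add_mem' := by
    rintro f g ⟨P, hP, hP', hf⟩ ⟨Q, hQ, hQ', hg⟩
    refine ⟨P + Q, ?_, fun w z => ?_, fun u => ?_⟩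
    · simp only [IsHarmonicPoly, map_add, Finset.sum_add_distrib] at *
      rw [hP, hQ, add_zero]
    · have h1 := hP' w z
      have h2 := hQ' w z
      simp only [polyVal, map_add] at *
      rw [h1, h2, mul_add]
    · simp [hf, hg, polyVal]
  smul_mem' := by
    rintro c f ⟨P, hP, hP', hf⟩
    refine ⟨c • P, ?_, fun w z => ?_, fun u => ?_⟩
    · simp only [IsHarmonicPoly, Derivation.map_smul] at *
      rw [← Finset.smul_sum, hP, smul_zero]
    · have h1 := hP' w z
      simp only [polyVal, MvPolynomial.smul_eval] at *
      rw [h1]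
      ring
    · simp [hf, polyVal, MvPolynomial.smul_eval]

/-- `T` has precisely one positive eigenvalue, and its eigenspace is the space of constants. -/
def OnePositiveEigenvalue {n : ℕ} [NeZero n] (T : (Sph n → ℂ) → Sph n → ℂ) : Prop :=
  ∃ r : ℝ, 0 < r ∧ eigenfunctions T (r : ℂ) = constants n ∧
    ∀ s : ℝ, 0 < s → (IsEigenvalue T (s : ℂ) ↔ s = r)

end UnitaryVal

end

/-! Each of the operators has the form `D = α JN² + β Δ + γ` with `γ = α + (2n - 1) β`. On the
restriction to the sphere of a polynomial `P` of bidegree `(k, l)` in `z` and `z̄` it acts by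

  `D (P|S) = λ(k, l) P|S + β (ΔP)|S`,   `λ(k, l) = γ - α (k - l)² - β (k + l) (k + l + 2n - 2)`,

where the euclidean Laplacian `ΔP` has bidegree `(k - 1, l - 1)` (`extOp_radialExtC`). So spherical
harmonics are eigenfunctions, and `D` is triangular on all polynomials; the decomposition of
polynomials into harmonic ones is not needed.

A `C²` solution of `D f = s f` is tested against polynomials. Functions on the sphere are identified
with their extensions to `ℂⁿ ∖ {0}` that are constant along rays, and integrated over `ℂⁿ` against a
smooth radial cutoff supported in an annulus. Two applications of the divergence theorem show that
`D` is symmetric for this integral (`integral_extOp_symm`): for `Δ` because the gradient of the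
weight is radial while the gradients of the functions are tangential, and for `JN` because `x ↦ ix`
is divergence free and tangent to the spheres. Hence, for a monomial `m` of bidegree `(k, l)`,

  `(s - λ(k, l)) ∫ f m = β ∫ f Δm`,

and by induction on the degree `f` is orthogonal to all monomials once it is orthogonal to those
with `λ(k, l) = s` (`IsWeakEigen.orthogonal`). By the Stone-Weierstrass theorem `f` then vanishes
(`eq_zero_of_orthogonal`). Subtracting from an arbitrary solution its orthogonal projection to a
finite-dimensional space of known solutions identifies the eigenspaces (`eigenfunctions_eq_span`).

What remains is the sign of `λ(k, l)`: it is `γ` at `(0, 0)`, it vanishes at `(1, 0)` and `(0, 1)`,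
and under the inequalities of the theorem it is negative as soon as `k + l ≥ 2`; in the boundary
case it vanishes also at `(1, 1)`. For `α < 0` the worst case is `|k - l| = k + l`, which `α + β ≥
0` controls; for `α ≥ 0` it is `k = l = 1`, where `λ = γ - 4nβ`. -/

noncomputable section

open scoped Laplacian InnerProductSpace ComplexConjugate
open MeasureTheory UnitaryVal

/-! ### Laplacians of products, polynomials and powers of the norm -/

section
variable {ι E F : Type*} [Fintype ι] [NormedAddCommGroup E] [InnerProductSpace ℝ E]
  [NormedAddCommGroup F] [NormedSpace ℝ F]

theorem contDiffAt_fderiv_apply {f : E → F} {x : E} {k m : ℕ∞ω} (hf : ContDiffAt ℝ k f x)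
    (hm : m + 1 ≤ k) {v : E → E} (hv : ContDiffAt ℝ m v x) :
    ContDiffAt ℝ m (fun y => fderiv ℝ f y (v y)) x :=
  (hf.fderiv_right hm).clm_apply hv

theorem laplacian_eq_sum_fderiv [FiniteDimensional ℝ E] (b : OrthonormalBasis ι ℝ E) {f : E → F}
    {x : E}
    (hf : ContDiffAt ℝ 2 f x) :
    Δ f x = ∑ i, fderiv ℝ (fun y => fderiv ℝ f y (b i)) x (b i) := by
  rw [InnerProductSpace.laplacian_eq_iteratedFDeriv_orthonormalBasis f b]
  refine Finset.sum_congr rfl fun i _ => ?_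
  have h : DifferentiableAt ℝ (fderiv ℝ f) x :=
    (hf.fderiv_right (m := 1) (by norm_num)).differentiableAt (by norm_num)
  rw [iteratedFDeriv_two_apply, fderiv_clm_apply h (differentiableAt_const _)]
  simp

theorem laplacian_mul [FiniteDimensional ℝ E] (b : OrthonormalBasis ι ℝ E) {f g : E → ℂ} {x : E}
    (hf : ContDiffAt ℝ 2 f x) (hg : ContDiffAt ℝ 2 g x) :
    Δ (fun y => f y * g y) x = f x * Δ g x + 2 * ∑ i, fderiv ℝ f x (b i) * fderiv ℝ g x (b i)
      + g x * Δ f x := by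
  rw [laplacian_eq_sum_fderiv b (hf.mul hg), laplacian_eq_sum_fderiv b hf,
    laplacian_eq_sum_fderiv b hg, Finset.mul_sum, Finset.mul_sum, Finset.mul_sum,
    ← Finset.sum_add_distrib, ← Finset.sum_add_distrib]
  refine Finset.sum_congr rfl fun i _ => ?_
  have hev : (fun y => fderiv ℝ (fun y => f y * g y) y (b i)) =ᶠ[nhds x]
      fun y => f y * fderiv ℝ g y (b i) + g y * fderiv ℝ f y (b i) := by
    filter_upwards [hf.eventually (by simp), hg.eventually (by simp)] with y h1 h2
    rw [fderiv_fun_mul (h1.differentiableAt (by norm_num)) (h2.differentiableAt (by norm_num))]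
    simp
  have d1 := hf.differentiableAt (n := 2) (by norm_num)
  have d2 := hg.differentiableAt (n := 2) (by norm_num)
  have d3 := (contDiffAt_fderiv_apply hf (m := 1) (by norm_num)
    (contDiffAt_const (c := b i))).differentiableAt (by norm_num)
  have d4 := (contDiffAt_fderiv_apply hg (m := 1) (by norm_num)
    (contDiffAt_const (c := b i))).differentiableAt (by norm_num)
  rw [hev.fderiv_eq, fderiv_fun_add (d1.fun_mul d4) (d2.fun_mul d3), fderiv_fun_mul d1 d4,
    fderiv_fun_mul d2 d3]
  simp
  ring

theorem hasFDerivAt_eval {σ : Type*} [Fintype σ] (ℓ : σ → E →L[ℝ] ℂ) (P : MvPolynomial σ ℂ)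
    (x : E) :
    HasFDerivAt (fun y => MvPolynomial.eval (fun s => ℓ s y) P)
      (∑ s, MvPolynomial.eval (fun s => ℓ s x) (MvPolynomial.pderiv s P) • ℓ s) x := by
  classical
  induction P using MvPolynomial.induction_on with
  | C a =>
    refine HasFDerivAt.congr_fderiv (by simpa using hasFDerivAt_const a x) ?_
    ext v
    simp
  | add p q hp hq =>
    simp only [map_add]
    refine (hp.fun_add hq).congr_fderiv ?_
    ext v
    simp [add_mul, Finset.sum_add_distrib]
  | mul_X p i hp =>
    have h := hp.fun_mul ((ℓ i).hasFDerivAt (x := x))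
    simp only [map_mul, MvPolynomial.eval_X, Derivation.leibniz]
    refine h.congr_fderiv ?_
    ext v
    simp [MvPolynomial.pderiv_X, Pi.single_apply, add_mul, Finset.sum_add_distrib, apply_ite,
      Finset.mul_sum]
    exact Finset.sum_congr rfl fun _ _ => by ring

theorem contDiff_eval {σ : Type*} [Fintype σ] (ℓ : σ → E →L[ℝ] ℂ) (P : MvPolynomial σ ℂ)
    {k : ℕ∞ω} : ContDiff ℝ k (fun y => MvPolynomial.eval (fun s => ℓ s y) P) := by
  simp only [MvPolynomial.eval_eq']
  fun_prop

/-- The Laplacian of a polynomial in real-linear functionals `ℓ s` is governed by the (complex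
bilinear) Gram matrix of these functionals; this covers both the coordinates `x, y` and `z, z̄`. -/
theorem laplacian_eval [FiniteDimensional ℝ E] {σ : Type*} [Fintype σ]
    (b : OrthonormalBasis ι ℝ E) (ℓ : σ → E →L[ℝ] ℂ)
    (P : MvPolynomial σ ℂ) (x : E) :
    Δ (fun y => MvPolynomial.eval (fun s => ℓ s y) P) x
      = ∑ s, ∑ t, (∑ i, ℓ s (b i) * ℓ t (b i)) *
        MvPolynomial.eval (fun s => ℓ s x) (MvPolynomial.pderiv t (MvPolynomial.pderiv s P)) := by
  rw [laplacian_eq_sum_fderiv b (contDiff_eval ℓ P).contDiffAt]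
  have h1 : ∀ i, (fun y => fderiv ℝ (fun y => MvPolynomial.eval (fun s => ℓ s y) P) y (b i))
      = fun y => ∑ s, MvPolynomial.eval (fun s => ℓ s y) (MvPolynomial.pderiv s P) * ℓ s (b i) := by
    intro i
    ext y
    rw [(hasFDerivAt_eval ℓ P y).fderiv]
    simp
  have h2 : ∀ i, fderiv ℝ (fun y => ∑ s,
      MvPolynomial.eval (fun s => ℓ s y) (MvPolynomial.pderiv s P) * ℓ s (b i)) x (b i)
      = ∑ s, ∑ t, ℓ s (b i) * ℓ t (b i) *
        MvPolynomial.eval (fun s => ℓ s x) (MvPolynomial.pderiv t (MvPolynomial.pderiv s P)) := by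
    intro i
    have := HasFDerivAt.fun_sum (u := Finset.univ) (fun s _ =>
      (hasFDerivAt_eval ℓ (MvPolynomial.pderiv s P) x).mul_const (ℓ s (b i)))
    rw [this.fderiv]
    simp [Finset.mul_sum]
    refine Finset.sum_congr rfl fun s _ => Finset.sum_congr rfl fun t _ => by ring
  simp only [h1, h2, Finset.sum_mul]
  rw [Finset.sum_comm]
  exact Finset.sum_congr rfl fun s _ => Finset.sum_comm

theorem hasFDerivAt_norm_sq_rpow (s : ℝ) {x : E} (hx : x ≠ 0) :
    HasFDerivAt (fun y : E => (‖y‖ ^ 2) ^ s) ((2 * s * (‖x‖ ^ 2) ^ (s - 1)) • innerSL ℝ x) x := by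
  have h := ((hasStrictFDerivAt_norm_sq x).hasFDerivAt).rpow_const (p := s)
    (Or.inl (by simpa using hx))
  refine h.congr_fderiv ?_
  ext v
  simp
  ring

theorem laplacian_norm_sq_rpow [FiniteDimensional ℝ E] (b : OrthonormalBasis ι ℝ E) (s : ℝ)
    {x : E} (hx : ‖x‖ = 1) :
    Δ (fun y : E => (‖y‖ ^ 2) ^ s) x = 2 * s * (2 * s + Fintype.card ι - 2) := by
  have hx0 : x ≠ 0 := by rintro rfl; simp at hx
  have hc : ContDiffAt ℝ 2 (fun y : E => (‖y‖ ^ 2) ^ s) x :=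
    (contDiff_norm_sq ℝ).contDiffAt.rpow_const_of_ne (by simpa using hx0)
  rw [laplacian_eq_sum_fderiv b hc]
  have h1 : ∀ i, (fun y => fderiv ℝ (fun y : E => (‖y‖ ^ 2) ^ s) y (b i)) =ᶠ[nhds x]
      fun y => 2 * s * ((‖y‖ ^ 2) ^ (s - 1) * inner ℝ (b i) y) := by
    intro i
    filter_upwards [isOpen_ne.mem_nhds hx0] with y hy
    rw [(hasFDerivAt_norm_sq_rpow s hy).fderiv]
    simp [real_inner_comm]
    ring
  have h2 : ∀ i, fderiv ℝ (fun y => 2 * s * ((‖y‖ ^ 2) ^ (s - 1) * inner ℝ (b i) y)) x (b i)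
      = 2 * s * (2 * (s - 1) * inner ℝ (b i) x ^ 2 + 1) := by
    intro i
    have := ((hasFDerivAt_norm_sq_rpow (s - 1) hx0).fun_mul
      ((innerSL ℝ (b i)).hasFDerivAt (x := x))).const_mul (2 * s)
    simp only [innerSL_apply_apply] at this
    rw [this.fderiv]
    simp [hx, real_inner_comm]
    ring
  rw [Finset.sum_congr rfl fun i _ => by rw [(h1 i).fderiv_eq, h2 i],
    ← Finset.mul_sum, Finset.sum_add_distrib, ← Finset.mul_sum, b.sum_sq_inner_right, hx]
  simp only [Finset.sum_const, Finset.card_univ, nsmul_eq_mul]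
  ring
end

/-! ### Integration by parts against radial weights -/

section
variable {ι E : Type*} [Fintype ι] [NormedAddCommGroup E] [InnerProductSpace ℝ E]

/-- A function on `E` which is constant along the open rays from the origin and of class `C^k` away
from the origin. Its value at the origin is immaterial. -/
structure IsRadiallyConstant (k : ℕ∞ω) (F : E → ℂ) : Prop where
  map_smul : ∀ c : ℝ, 0 < c → ∀ x, F (c • x) = F x
  contDiffAt : ∀ x, x ≠ 0 → ContDiffAt ℝ k F x

/-- A smooth function on `ℝ` vanishing outside `(1/2, 2)`, so that `x ↦ ψ (‖x‖ ^ 2)` is a smooth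
radial weight supported in an annulus. -/
structure IsCutoff (ψ : ℝ → ℝ) : Prop where
  contDiff : ContDiff ℝ ∞ ψ
  eq_zero_of_le : ∀ t, t ≤ 1 / 2 → ψ t = 0
  eq_zero_of_ge : ∀ t, 2 ≤ t → ψ t = 0

theorem IsCutoff.id_mul {ψ : ℝ → ℝ} (h : IsCutoff ψ) : IsCutoff (fun t => t * ψ t) where
  contDiff := contDiff_id.mul h.contDiff
  eq_zero_of_le t ht := by simp [h.eq_zero_of_le t ht]
  eq_zero_of_ge t ht := by simp [h.eq_zero_of_ge t ht]

theorem IsCutoff.eventually_eq_zero {E : Type*} [NormedAddCommGroup E] {ψ : ℝ → ℝ}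
    (hψ : IsCutoff ψ) :
    ∀ᶠ x : E in nhds 0, ψ (‖x‖ ^ 2) = 0 := by
  have : ∀ᶠ x : E in nhds 0, ‖x‖ ^ 2 < 1 / 2 :=
    (by fun_prop : Continuous fun x : E => ‖x‖ ^ 2).continuousAt.eventually_lt
      continuousAt_const (by simp)
  filter_upwards [this] with x hx using hψ.eq_zero_of_le _ hx.le

theorem IsCutoff.contDiffAt {ψ : ℝ → ℝ} (hψ : IsCutoff ψ) (x : E) (k : ℕ) :
    ContDiffAt ℝ k (fun y : E => (ψ (‖y‖ ^ 2) : ℂ)) x :=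
  (Complex.ofRealCLM.contDiff.comp
    ((hψ.contDiff.of_le (by exact_mod_cast le_top)).comp (contDiff_norm_sq ℝ))).contDiffAt

theorem IsCutoff.contDiff_mul {ψ : ℝ → ℝ} (hψ : IsCutoff ψ) {h : E → ℂ} {k : ℕ}
    (hh : ∀ x, x ≠ 0 → ContDiffAt ℝ k h x) :
    ContDiff ℝ k (fun x => (ψ (‖x‖ ^ 2) : ℂ) * h x) := by
  refine contDiff_iff_contDiffAt.2 fun x => ?_
  rcases eq_or_ne x 0 with rfl | hx
  · refine (contDiffAt_const (c := (0 : ℂ))).congr_of_eventuallyEq ?_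
    filter_upwards [hψ.eventually_eq_zero] with y hy
    simp [hy]
  · exact (hψ.contDiffAt x k).mul (hh x hx)

theorem IsCutoff.hasCompactSupport_mul {E : Type*} [NormedAddCommGroup E] [ProperSpace E]
    {ψ : ℝ → ℝ} (hψ : IsCutoff ψ) (h : E → ℂ) :
    HasCompactSupport (fun x => (ψ (‖x‖ ^ 2) : ℂ) * h x) := by
  refine HasCompactSupport.intro (isCompact_closedBall (0 : E) 2) fun x hx => ?_
  have : (2 : ℝ) < ‖x‖ := by simpa using hx
  rw [hψ.eq_zero_of_ge _ (by nlinarith)]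
  simp

theorem IsCutoff.fderiv_apply {ψ : ℝ → ℝ} (hψ : IsCutoff ψ) (x v : E) :
    fderiv ℝ (fun y : E => (ψ (‖y‖ ^ 2) : ℂ)) x v
      = ((2 * deriv ψ (‖x‖ ^ 2) : ℝ) : ℂ) * ((inner ℝ x v : ℝ) : ℂ) := by
  have h1 : HasDerivAt ψ (deriv ψ (‖x‖ ^ 2)) (‖x‖ ^ 2) :=
    (hψ.contDiff.differentiable (by simp)).differentiableAt.hasDerivAt
  have h2 := h1.comp_hasFDerivAt x (hasStrictFDerivAt_norm_sq x).hasFDerivAt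
  have h3 := (Complex.ofRealCLM.hasFDerivAt (x := ψ (‖x‖ ^ 2))).comp x h2
  have h4 : fderiv ℝ (fun y : E => (ψ (‖y‖ ^ 2) : ℂ)) x = _ := h3.fderiv
  rw [h4]
  simp
  ring

/-- Euler's relation in degree zero. -/
theorem IsRadiallyConstant.fderiv_self {F : E → ℂ} (hF : IsRadiallyConstant 1 F) {x : E}
    (hx : x ≠ 0) : fderiv ℝ F x x = 0 := by
  have h1 : HasDerivAt (fun t : ℝ => (1 + t) • x) x 0 := by
    simpa using ((hasDerivAt_id (0 : ℝ)).const_add 1).smul_const x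
  have h2 := ((hF.contDiffAt x hx).differentiableAt (by norm_num)).hasFDerivAt
  have h3 := HasFDerivAt.comp_hasDerivAt (0 : ℝ) (by simpa using h2) h1
  have h4 : (F ∘ fun t : ℝ => (1 + t) • x) =ᶠ[nhds 0] fun _ => F x := by
    filter_upwards [lt_mem_nhds (show (-1 : ℝ) < 0 by norm_num)] with t ht
    exact hF.map_smul _ (by linarith) x
  exact h3.unique ((hasDerivAt_const 0 (F x)).congr_of_eventuallyEq h4)

variable [FiniteDimensional ℝ E] [MeasurableSpace E] [BorelSpace E]

theorem integrable_fderiv_apply {V : E → ℂ} (hV : ContDiff ℝ 1 V) (hs : HasCompactSupport V)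
    (v : E) : Integrable (fun x => fderiv ℝ V x v) :=
  ((hV.continuous_fderiv (by norm_num)).clm_apply continuous_const).integrable_of_hasCompactSupport
      (hs.fderiv_apply (𝕜 := ℝ) v)

theorem integral_fderiv_eq_zero {V : E → ℂ} (hV : ContDiff ℝ 1 V) (hs : HasCompactSupport V)
    (v : E) : ∫ x, fderiv ℝ V x v = 0 := by
  have hd := integrable_fderiv_apply hV hs v
  have := integral_mul_fderiv_eq_neg_fderiv_mul_of_integrable (μ := (volume : Measure E))
    (f := V) (g := fun _ => (1 : ℂ)) (v := v) (by simpa using hd) (by simp)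
    (by simpa using hV.continuous.integrable_of_hasCompactSupport hs)
    (fun x _ => (hV.differentiable (by norm_num)).differentiableAt)
    (fun x _ => differentiableAt_const _)
  simpa using this

/-- The linear vector field `x ↦ A x` of a skew-symmetric `A` is divergence free. -/
theorem integral_fderiv_skew (b : OrthonormalBasis ι ℝ E) (A : E →L[ℝ] E)
    (hA : ∀ x, inner ℝ x (A x) = 0)
    {H : E → ℂ} (hH : ContDiff ℝ 1 H) (hs : HasCompactSupport H) :
    ∫ x, fderiv ℝ H x (A x) = 0 := by
  have hcd : ∀ i, ContDiff ℝ 1 fun x => ((inner ℝ (b i) (A x) : ℝ) : ℂ) * H x := fun i =>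
    (Complex.ofRealCLM.contDiff.comp ((innerSL ℝ (b i)).contDiff.comp A.contDiff)).mul hH
  have key : ∀ x, fderiv ℝ H x (A x)
      = ∑ i, fderiv ℝ (fun x => ((inner ℝ (b i) (A x) : ℝ) : ℂ) * H x) x (b i) := by
    intro x
    conv_lhs => rw [← b.sum_repr' (A x), map_sum]
    refine Finset.sum_congr rfl fun i _ => ?_
    have h1 : HasFDerivAt (fun x => ((inner ℝ (b i) (A x) : ℝ) : ℂ))
        (Complex.ofRealCLM ∘L (innerSL ℝ (b i)) ∘L A) x :=
      (Complex.ofRealCLM ∘L (innerSL ℝ (b i)) ∘L A).hasFDerivAt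
    rw [(h1.fun_mul (hH.differentiable (by norm_num)).differentiableAt.hasFDerivAt).fderiv]
    simp [hA]
  simp_rw [key]
  rw [integral_finsetSum _ fun i _ => integrable_fderiv_apply (hcd i) hs.mul_left _]
  exact Finset.sum_eq_zero fun i _ => integral_fderiv_eq_zero (hcd i) hs.mul_left _

/-- A tangential linear vector field acts on radially constant functions as a skew-symmetric
operator, since it annihilates the radial weight. -/
theorem integral_cutoff_skew (b : OrthonormalBasis ι ℝ E) (A : E →L[ℝ] E)
    (hA : ∀ x, inner ℝ x (A x) = 0) {ψ : ℝ → ℝ} (hψ : IsCutoff ψ) {F G : E → ℂ}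
    (hF : IsRadiallyConstant 1 F) (hG : IsRadiallyConstant 1 G) :
    ∫ x, (ψ (‖x‖ ^ 2) : ℂ) * (fderiv ℝ F x (A x) * G x + F x * fderiv ℝ G x (A x)) = 0 := by
  have hFG : ∀ x, x ≠ 0 → ContDiffAt ℝ 1 (fun y => F y * G y) x := fun x hx =>
    (hF.contDiffAt x hx).mul (hG.contDiffAt x hx)
  rw [← integral_fderiv_skew b A hA (hψ.contDiff_mul (k := 1) hFG) (hψ.hasCompactSupport_mul _)]
  refine integral_congr_ae (.of_forall fun x => ?_)
  dsimp only
  rcases eq_or_ne x 0 with rfl | hx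
  · simp [hψ.eq_zero_of_le 0]
  · have d1 := (hF.contDiffAt x hx).differentiableAt (by norm_num)
    have d2 := (hG.contDiffAt x hx).differentiableAt (by norm_num)
    rw [fderiv_fun_mul ((hψ.contDiffAt x 1).differentiableAt (by norm_num)) (d1.fun_mul d2),
      fderiv_fun_mul d1 d2]
    simp [hψ.fderiv_apply, hA]
    ring

/-- Green's identity: the vector field `ψ (G ∇F - F ∇G)` has divergence `ψ (G ΔF - F ΔG)`, because
`∇ψ` is radial and radially constant functions have tangential gradients. -/
theorem integral_cutoff_laplacian (b : OrthonormalBasis ι ℝ E) {ψ : ℝ → ℝ} (hψ : IsCutoff ψ)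
    {F G : E → ℂ} (hF : IsRadiallyConstant 2 F) (hG : IsRadiallyConstant 2 G) :
    ∫ x, (ψ (‖x‖ ^ 2) : ℂ) * (Δ F x * G x - F x * Δ G x) = 0 := by
  have hF1 : IsRadiallyConstant 1 F := ⟨hF.1, fun x hx => (hF.2 x hx).of_le (by norm_num)⟩
  have hG1 : IsRadiallyConstant 1 G := ⟨hG.1, fun x hx => (hG.2 x hx).of_le (by norm_num)⟩
  have cF : ∀ i x, x ≠ 0 → ContDiffAt ℝ 1 (fun y => fderiv ℝ F y (b i)) x := fun i x hx =>
    contDiffAt_fderiv_apply (hF.2 x hx) (by norm_num) contDiffAt_const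
  have cG : ∀ i x, x ≠ 0 → ContDiffAt ℝ 1 (fun y => fderiv ℝ G y (b i)) x := fun i x hx =>
    contDiffAt_fderiv_apply (hG.2 x hx) (by norm_num) contDiffAt_const
  have cV : ∀ i, ContDiff ℝ 1 (fun y => (ψ (‖y‖ ^ 2) : ℂ) *
      (fderiv ℝ F y (b i) * G y - F y * fderiv ℝ G y (b i))) := fun i =>
    hψ.contDiff_mul (k := 1) fun x hx => ((cF i x hx).mul (hG1.2 x hx)).sub
      ((hF1.2 x hx).mul (cG i x hx))
  have key : ∀ x, (ψ (‖x‖ ^ 2) : ℂ) * (Δ F x * G x - F x * Δ G x)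
      = ∑ i, fderiv ℝ (fun y => (ψ (‖y‖ ^ 2) : ℂ) *
        (fderiv ℝ F y (b i) * G y - F y * fderiv ℝ G y (b i))) x (b i) := by
    intro x
    rcases eq_or_ne x 0 with rfl | hx
    · rw [Finset.sum_eq_zero, hψ.eq_zero_of_le _ (by simp)]
      · simp
      · intro i _
        have : (fun y => (ψ (‖y‖ ^ 2) : ℂ) *
          (fderiv ℝ F y (b i) * G y - F y * fderiv ℝ G y (b i))) =ᶠ[nhds 0] fun _ => 0 := by
          filter_upwards [hψ.eventually_eq_zero] with y hy
          simp [hy]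
        rw [this.fderiv_eq]
        simp
    · have dF := (hF1.2 x hx).differentiableAt (by norm_num)
      have dG := (hG1.2 x hx).differentiableAt (by norm_num)
      have dF' := fun i => (cF i x hx).differentiableAt (by norm_num)
      have dG' := fun i => (cG i x hx).differentiableAt (by norm_num)
      have hr : ∀ {K : E → ℂ}, IsRadiallyConstant 1 K →
          ∑ i, ((inner ℝ x (b i) : ℝ) : ℂ) * fderiv ℝ K x (b i) = 0 := by
        intro K hK
        have := hK.fderiv_self hx
        rw [← b.sum_repr' x, map_sum, b.sum_repr' x] at this
        simpa [real_inner_comm] using this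
      have hi : ∀ i, fderiv ℝ (fun y => (ψ (‖y‖ ^ 2) : ℂ) *
          (fderiv ℝ F y (b i) * G y - F y * fderiv ℝ G y (b i))) x (b i)
          = ((2 * deriv ψ (‖x‖ ^ 2) : ℝ) : ℂ) *
              (G x * (((inner ℝ x (b i) : ℝ) : ℂ) * fderiv ℝ F x (b i))
              - F x * (((inner ℝ x (b i) : ℝ) : ℂ) * fderiv ℝ G x (b i)))
            + (ψ (‖x‖ ^ 2) : ℂ) * (fderiv ℝ (fun y => fderiv ℝ F y (b i)) x (b i) * G x
              - F x * fderiv ℝ (fun y => fderiv ℝ G y (b i)) x (b i)) := by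
        intro i
        rw [fderiv_fun_mul ((hψ.contDiffAt x 1).differentiableAt (by norm_num))
          (((dF' i).fun_mul dG).fun_sub (dF.fun_mul (dG' i))),
          fderiv_fun_sub ((dF' i).fun_mul dG) (dF.fun_mul (dG' i)),
          fderiv_fun_mul (dF' i) dG, fderiv_fun_mul dF (dG' i)]
        simp [hψ.fderiv_apply]
        ring
      rw [laplacian_eq_sum_fderiv b (hF.2 x hx), laplacian_eq_sum_fderiv b (hG.2 x hx)]
      simp_rw [hi, Finset.sum_add_distrib, ← Finset.mul_sum, Finset.sum_sub_distrib,
        ← Finset.mul_sum, hr hF1, hr hG1, Finset.sum_mul]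
      simp
  simp_rw [key]
  rw [integral_finsetSum _ fun i _ => integrable_fderiv_apply (cV i)
    (hψ.hasCompactSupport_mul _) _]
  exact Finset.sum_eq_zero fun i _ => integral_fderiv_eq_zero (cV i) (hψ.hasCompactSupport_mul _) _
end

/-! ### Radial extension of functions on the sphere -/

variable {n : ℕ}

/-- The extension of a complex-valued function on the sphere to `ℂⁿ` that is constant along rays
(and set to `0` at the origin). -/
def radialExtC (f : Sph n → ℂ) (x : Cn n) : ℂ :=
  if h : x = 0 then 0
  else f ⟨‖x‖⁻¹ • x, by
    rw [mem_sphere_zero_iff_norm, norm_smul, norm_inv, norm_norm,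
      inv_mul_cancel₀ (norm_ne_zero_iff.mpr h)]⟩

theorem coe_sph_ne_zero (u : Sph n) : (u : Cn n) ≠ 0 := by
  intro h
  simpa [h] using norm_eq_of_mem_sphere u

theorem radialExtC_coe (f : Sph n → ℂ) (u : Sph n) : radialExtC f u = f u := by
  rw [radialExtC, dif_neg (coe_sph_ne_zero u)]
  congr
  simp

theorem radialExtC_smul (f : Sph n → ℂ) {c : ℝ} (hc : 0 < c) (x : Cn n) : radialExtC f
    (c • x) = radialExtC f x := by
  by_cases hx : x = 0
  · simp [hx]
  · rw [radialExtC, radialExtC, dif_neg hx, dif_neg (smul_ne_zero hc.ne' hx)]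
    congr 2
    rw [norm_smul, smul_smul, Real.norm_of_nonneg hc.le]
    congr 1
    field_simp

theorem radialExt_comp (L : ℂ →L[ℝ] ℝ) (f : Sph n → ℂ) :
    radialExt (fun u => L (f u)) = fun x => L (radialExtC f x) := by
  ext x
  simp only [radialExt, radialExtC]
  split_ifs <;> simp

/-- The radial projection `ℂⁿ ∖ {0} → S^{2n-1}` is smooth. -/
theorem contDiffAt_radialExtC [NeZero n] {f : Sph n → ℂ} (hf : IsC2 f) {x : Cn n} (hx : x ≠ 0) :
    ContDiffAt ℝ 2 (radialExtC f) x := by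
  let U : TopologicalSpace.Opens (Cn n) := ⟨{y | y ≠ 0}, isOpen_ne⟩
  have hg : ContMDiff 𝓘(ℝ, Cn n) 𝓘(ℝ, Cn n) 2 (fun y : U => ‖(y : Cn n)‖⁻¹ • (y : Cn n)) := by
    intro y
    refine contMDiffAt_subtype_iff (f := fun z : Cn n => ‖z‖⁻¹ • z).2 ?_
    exact (((contDiffAt_norm ℝ y.2).inv (norm_ne_zero_iff.2 y.2)).smul contDiffAt_id).contMDiffAt
  have hm : ∀ y : U, ‖(y : Cn n)‖⁻¹ • (y : Cn n) ∈ Metric.sphere (0 : Cn n) 1 := fun y => by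
    rw [mem_sphere_zero_iff_norm, norm_smul, norm_inv, norm_norm,
      inv_mul_cancel₀ (norm_ne_zero_iff.mpr y.2)]
  have h1 := ContMDiff.codRestrict_sphere (n := 2 * n - 1) hg hm
  have h2 : ContMDiff 𝓘(ℝ, Cn n) 𝓘(ℝ, ℂ) 2 (fun y : U => radialExtC f y) := by
    have := ContMDiff.comp (g := f) hf h1
    convert this using 1
    ext y
    simp only [radialExtC, dif_neg y.2]
    rfl
  have := contMDiffAt_subtype_iff.1 (h2 ⟨x, hx⟩)
  exact this.contDiffAt

theorem isRadiallyConstant_radialExtC [NeZero n] {f : Sph n → ℂ} (hf : IsC2 f) :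
    IsRadiallyConstant 2 (radialExtC f) :=
  ⟨fun _ hc x => radialExtC_smul f hc x, fun _ hx => contDiffAt_radialExtC hf hx⟩

theorem isC2_restrict [NeZero n] {P : Cn n → ℂ} (hP : ContDiff ℝ 2 P) :
    IsC2 (fun u : Sph n => P u) :=
  hP.contMDiff.comp contMDiff_coe_sphere

/-! ### The operators on radially constant functions -/

/-- Multiplication by `i` on `ℂⁿ`, as a real-linear map. -/
def mulI (n : ℕ) : Cn n →L[ℝ] Cn n :=
  (Complex.I • ContinuousLinearMap.id ℂ (Cn n)).restrictScalars ℝ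

theorem mulI_apply (x : Cn n) : mulI n x = Complex.I • x := rfl

theorem inner_mulI (x : Cn n) : inner ℝ x (mulI n x) = 0 := by
  simp [mulI_apply, PiLp.inner_apply, Complex.inner]
  refine Finset.sum_eq_zero fun _ _ => by ring

/-- The orthonormal basis `e_j, i e_j` of `ℂⁿ` over `ℝ`. -/
def cnBasis (n : ℕ) : OrthonormalBasis (Σ _ : Fin n, Fin 2) ℝ (Cn n) :=
  Pi.orthonormalBasis fun _ => Complex.orthonormalBasisOneI

/-- The derivative of a function on `ℂⁿ` along the vector field `x ↦ ix`. -/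
def rotDeriv (F : Cn n → ℂ) (x : Cn n) : ℂ := fderiv ℝ F x (mulI n x)

theorem hasDerivAt_rot (u : Cn n) :
    HasDerivAt (fun t : ℝ => Complex.exp (t * Complex.I) • u) (mulI n u) 0 := by
  have h : HasDerivAt (fun t : ℝ => Complex.exp (t * Complex.I)) Complex.I 0 := by
    have := ((Complex.ofRealCLM.hasDerivAt (x := (0:ℝ))).mul_const Complex.I).cexp
    simpa using this
  exact h.smul_const u

theorem hasDerivAt_rot_comp {F : Cn n → ℂ} {x : Cn n} (hF : DifferentiableAt ℝ F x) :
    HasDerivAt (fun t : ℝ => F (Complex.exp (t * Complex.I) • x)) (rotDeriv F x) 0 := by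
  have h := hF.hasFDerivAt
  exact HasFDerivAt.comp_hasDerivAt (0 : ℝ) (by simpa using h) (hasDerivAt_rot x)

theorem JN_eq (L : ℂ →L[ℝ] ℝ) {g : Sph n → ℝ} {G : Cn n → ℂ} (hg : ∀ u : Sph n, g u = L (G u))
    {u : Sph n} (hG : DifferentiableAt ℝ G u) : JN g u = L (rotDeriv G u) := by
  have h := L.hasFDerivAt.comp_hasDerivAt (0 : ℝ) (hasDerivAt_rot_comp hG)
  have h2 : (fun t : ℝ => g (rot t u)) = L ∘ fun t : ℝ => G (Complex.exp (t * Complex.I) • u) := by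
    ext t
    simp [hg, rot]
  rw [JN, h2, h.deriv]

theorem IsRadiallyConstant.rotDeriv {F : Cn n → ℂ} (hF : IsRadiallyConstant 2 F) :
    IsRadiallyConstant 1 (rotDeriv F) := by
  refine ⟨fun c hc x => ?_, fun x hx =>
    contDiffAt_fderiv_apply (hF.2 x hx) (by norm_num) (mulI n).contDiff.contDiffAt⟩
  have h := fderiv_comp_smul (𝕜 := ℝ) (f := F) (x := x) c
  have h2 : (fun y => F (c • y)) = F := funext fun y => hF.1 c hc y
  rw [h2] at h
  simp [_root_.rotDeriv, h]

/-- The operator `α JN² + β Δ + γ` in terms of radial extensions. The factor `‖x‖ ^ 2` makes it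
preserve functions that are constant along rays. -/
def extOp (α β γ : ℝ) (F : Cn n → ℂ) (x : Cn n) : ℂ :=
  α * rotDeriv (rotDeriv F) x + β * ‖x‖ ^ 2 * Δ F x + γ * F x

theorem laplacian_smul_of_radial {F : Cn n → ℂ} (hF : IsRadiallyConstant 2 F) {c : ℝ}
    (hc : 0 < c) {x : Cn n} (hx : x ≠ 0) : (c : ℂ) ^ 2 * Δ F (c • x) = Δ F x := by
  rw [laplacian_eq_sum_fderiv (cnBasis n) (hF.2 _ (smul_ne_zero hc.ne' hx)),
    laplacian_eq_sum_fderiv (cnBasis n) (hF.2 _ hx), Finset.mul_sum]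
  refine Finset.sum_congr rfl fun i _ => ?_
  have h2 : (fun y => F (c • y)) = F := funext fun y => hF.1 c hc y
  have h3 : ∀ y, fderiv ℝ F y (cnBasis n i) = c * fderiv ℝ F (c • y) (cnBasis n i) := by
    intro y
    have h := fderiv_comp_smul (𝕜 := ℝ) (f := F) (x := y) c
    rw [h2] at h
    simp [h]
  have h4 := fderiv_comp_smul (𝕜 := ℝ) (f := fun y => fderiv ℝ F y (cnBasis n i)) (x := x) c
  have h5 : fderiv ℝ (fun y => fderiv ℝ F y (cnBasis n i)) x
      = fderiv ℝ (fun y => (c : ℂ) * fderiv ℝ F (c • y) (cnBasis n i)) x := by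
    congr 1
    exact funext h3
  have hd : DifferentiableAt ℝ (fun y => fderiv ℝ F y (cnBasis n i)) (c • x) :=
    (contDiffAt_fderiv_apply (hF.2 _ (smul_ne_zero hc.ne' hx)) (m := 1) (by norm_num)
      contDiffAt_const).differentiableAt (by norm_num)
  rw [h5, fderiv_const_mul, h4]
  · simp; ring
  · exact hd.comp x (differentiableAt_id.const_smul c)

theorem extOp_smul {F : Cn n → ℂ} (α β γ : ℝ) (hF : IsRadiallyConstant 2 F) {c : ℝ}
    (hc : 0 < c) {x : Cn n} (hx : x ≠ 0) : extOp α β γ F (c • x) = extOp α β γ F x := by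
  have h1 : IsRadiallyConstant 1 (rotDeriv F) := hF.rotDeriv
  have h2 := fderiv_comp_smul (𝕜 := ℝ) (f := rotDeriv F) (x := x) c
  have h3 : (fun y => rotDeriv F (c • y)) = rotDeriv F := funext fun y => h1.1 c hc y
  rw [h3] at h2
  rw [extOp, extOp, ← laplacian_smul_of_radial hF hc hx, hF.1 c hc,
    show rotDeriv (rotDeriv F) (c • x) = rotDeriv (rotDeriv F) x by
      simp only [rotDeriv, h2, map_smul, smul_apply], norm_smul,
    Real.norm_of_nonneg hc.le]
  push_cast
  ring

/-- On `C²` functions the complexified operator is the restriction of `extOp` to the sphere. -/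
theorem complexify_eq_extOp [NeZero n] {α β γ : ℝ} {D : (Sph n → ℝ) → Sph n → ℝ}
    (hD : ∀ f u, D f u = α * JN (JN f) u + β * sphLaplacian f u + γ * f u)
    {f : Sph n → ℂ} (hf : IsC2 f) (u : Sph n) :
    complexify D f u = extOp α β γ (radialExtC f) u := by
  have hF := isRadiallyConstant_radialExtC hf
  have key : ∀ L : ℂ →L[ℝ] ℝ, D (fun v => L (f v)) u = L (extOp α β γ (radialExtC f) u) := by
    intro L
    have h1 : ∀ v : Sph n, JN (fun v => L (f v)) v = L (rotDeriv (radialExtC f) v) := fun v =>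
      JN_eq L (fun w => by rw [radialExtC_coe])
        ((hF.2 v (coe_sph_ne_zero v)).differentiableAt (by norm_num))
    have h2 : JN (JN (fun v => L (f v))) u = L (rotDeriv (rotDeriv (radialExtC f)) u) :=
      JN_eq L h1 (((hF.rotDeriv).2 u (coe_sph_ne_zero u)).differentiableAt
        (by norm_num))
    have h3 : sphLaplacian (fun v => L (f v)) u = L (Δ (radialExtC f) u) := by
      rw [sphLaplacian, radialExt_comp]
      exact (hF.2 u (coe_sph_ne_zero u)).laplacian_CLM_comp_left
    rw [hD, h2, h3, extOp, radialExtC_coe]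
    have hs : ∀ (r : ℝ) (z : ℂ), L (r * z) = r * L z := fun r z => by
      rw [← Complex.real_smul, map_smul, smul_eq_mul]
    simp [hs]
  have hre := key Complex.reCLM
  have him := key Complex.imCLM
  simp only [Complex.reCLM_apply, Complex.imCLM_apply] at hre him
  rw [complexify, hre, him, mul_comm, Complex.re_add_im]

theorem ContDiffAt.contDiffAt_laplacian {F : Cn n → ℂ} {x : Cn n} (hF : ContDiffAt ℝ 2 F x) :
    ContDiffAt ℝ 0 (Δ F) x := by
  have h : Δ F =ᶠ[nhds x] fun y => ∑ i,
      fderiv ℝ (fun y => fderiv ℝ F y (cnBasis n i)) y (cnBasis n i) := by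
    filter_upwards [hF.eventually (by simp)] with y hy
    exact laplacian_eq_sum_fderiv _ hy
  refine ContDiffAt.congr_of_eventuallyEq (ContDiffAt.sum fun i _ => ?_) h
  exact contDiffAt_fderiv_apply (contDiffAt_fderiv_apply hF (m := 1) (by norm_num)
    contDiffAt_const) (by norm_num) contDiffAt_const

theorem IsCutoff.integrable_mul {ψ : ℝ → ℝ} (hψ : IsCutoff ψ) {h : Cn n → ℂ}
    (hh : ∀ x, x ≠ 0 → ContDiffAt ℝ 0 h x) :
    Integrable (fun x => (ψ (‖x‖ ^ 2) : ℂ) * h x) :=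
  (hψ.contDiff_mul (k := 0) hh).continuous.integrable_of_hasCompactSupport
    (hψ.hasCompactSupport_mul _)

/-- `extOp` is symmetric with respect to a radial weight. -/
theorem integral_extOp_symm {φ : ℝ → ℝ} (hφ : IsCutoff φ) (α β γ : ℝ) {F G : Cn n → ℂ}
    (hF : IsRadiallyConstant 2 F) (hG : IsRadiallyConstant 2 G) :
    ∫ x, (φ (‖x‖ ^ 2) : ℂ) * (extOp α β γ F x * G x - F x * extOp α β γ G x) = 0 := by
  have hF1 : IsRadiallyConstant 1 F := ⟨hF.1, fun x hx => (hF.2 x hx).of_le (by norm_num)⟩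
  have hG1 : IsRadiallyConstant 1 G := ⟨hG.1, fun x hx => (hG.2 x hx).of_le (by norm_num)⟩
  have z {k : ℕ∞ω} {H : Cn n → ℂ} {x : Cn n} (h : ContDiffAt ℝ k H x) : ContDiffAt ℝ 0 H x :=
    h.of_le (by simp)
  have zr {H : Cn n → ℂ} {x : Cn n} (hx : x ≠ 0) (h : IsRadiallyConstant 1 H) :
      ContDiffAt ℝ 0 (fun x => fderiv ℝ H x (mulI n x)) x :=
    contDiffAt_fderiv_apply (h.2 x hx) (by norm_num) (mulI n).contDiff.contDiffAt
  have h1 := integral_cutoff_skew (cnBasis n) (mulI n) inner_mulI hφ hF.rotDeriv hG1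
  have h2 := integral_cutoff_skew (cnBasis n) (mulI n) inner_mulI hφ hF1 hG.rotDeriv
  have h3 := integral_cutoff_laplacian (cnBasis n) hφ.id_mul hF hG
  have i1 := hφ.integrable_mul (n := n) (h := fun x => fderiv ℝ (rotDeriv F) x (mulI n x) * G x
      + rotDeriv F x * fderiv ℝ G x (mulI n x)) fun x hx =>
    ((zr hx hF.rotDeriv).mul (z (hG.2 x hx))).add ((z (hF.rotDeriv.2 x hx)).mul (zr hx hG1))
  have i2 := hφ.integrable_mul (n := n) (h := fun x => fderiv ℝ F x (mulI n x) * rotDeriv G x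
      + F x * fderiv ℝ (rotDeriv G) x (mulI n x)) fun x hx =>
    ((zr hx hF1).mul (z (hG.rotDeriv.2 x hx))).add ((z (hF.2 x hx)).mul (zr hx hG.rotDeriv))
  have i3 := hφ.id_mul.integrable_mul (n := n) (h := fun x => Δ F x * G x - F x * Δ G x)
    fun x hx => ((hF.2 x hx).contDiffAt_laplacian.mul (z (hG.2 x hx))).sub
      ((z (hF.2 x hx)).mul (hG.2 x hx).contDiffAt_laplacian)
  calc _ = ∫ x, (α : ℂ) * ((φ (‖x‖ ^ 2) : ℂ) * (fderiv ℝ (rotDeriv F) x (mulI n x) * G x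
              + rotDeriv F x * fderiv ℝ G x (mulI n x))
            - (φ (‖x‖ ^ 2) : ℂ) * (fderiv ℝ F x (mulI n x) * rotDeriv G x
              + F x * fderiv ℝ (rotDeriv G) x (mulI n x)))
          + (β : ℂ) * (((‖x‖ ^ 2 * φ (‖x‖ ^ 2) : ℝ) : ℂ) * (Δ F x * G x - F x * Δ G x)) := by
        refine integral_congr_ae (.of_forall fun x => ?_)
        simp only [extOp, rotDeriv]
        push_cast
        ring
    _ = 0 := by
        have i12 := (i1.sub i2).const_mul (α : ℂ)
        simp only [Pi.sub_apply] at i12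
        rw [integral_add i12 (i3.const_mul _), integral_const_mul,
          integral_const_mul, integral_sub i1 i2, h1, h2, h3]
        simp

/-! ### An integral over the sphere -/

theorem exists_isCutoff : ∃ φ : ℝ → ℝ, IsCutoff φ ∧ (∀ t, 0 ≤ φ t) ∧ φ 1 ≠ 0 := by
  let f : ContDiffBump (1 : ℝ) := ⟨1 / 4, 1 / 2, by norm_num, by norm_num⟩
  refine ⟨f, ⟨f.contDiff, fun t ht => f.zero_of_le_dist ?_, fun t ht => f.zero_of_le_dist ?_⟩,
    fun t => f.nonneg, by rw [f.one_of_mem_closedBall (by simp [f])]; norm_num⟩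
  · rw [Real.dist_eq, abs_sub_comm, abs_of_nonneg (by linarith)]; simp only [f]; linarith
  · rw [Real.dist_eq, abs_of_nonneg (by linarith)]; simp only [f]; linarith

/-- A fixed nonnegative cutoff that does not vanish at `1`. -/
def cutoff : ℝ → ℝ := exists_isCutoff.choose

theorem isCutoff_cutoff : IsCutoff cutoff := exists_isCutoff.choose_spec.1

theorem cutoff_nonneg (t : ℝ) : 0 ≤ cutoff t := exists_isCutoff.choose_spec.2.1 t

theorem cutoff_one : cutoff 1 ≠ 0 := exists_isCutoff.choose_spec.2.2

theorem continuousAt_radialExtC (f : C(Sph n, ℂ)) {x : Cn n} (hx : x ≠ 0) :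
    ContinuousAt (radialExtC f) x := by
  have h : ContinuousOn (radialExtC f) {y | y ≠ 0} := by
    rw [continuousOn_iff_continuous_domRestrict]
    have : ({y : Cn n | y ≠ 0}.domRestrict (radialExtC f)) =
        fun y : {y : Cn n | y ≠ 0} => f ⟨‖(y : Cn n)‖⁻¹ • (y : Cn n), by
        rw [mem_sphere_zero_iff_norm, norm_smul, norm_inv, norm_norm,
          inv_mul_cancel₀ (norm_ne_zero_iff.mpr y.2)]⟩ := by
      ext y
      simp only [Set.domRestrict_apply, radialExtC, dif_neg y.2]
    rw [this]
    refine f.continuous.comp (Continuous.subtype_mk ?_ _)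
    exact (Continuous.inv₀ (by fun_prop) fun y => norm_ne_zero_iff.2 y.2).smul (by fun_prop)
  exact h.continuousAt (isOpen_ne.mem_nhds hx)

theorem integrable_cutoff_radialExtC (f : C(Sph n, ℂ)) :
    Integrable (fun x : Cn n => (cutoff (‖x‖ ^ 2) : ℂ) * radialExtC f x) :=
  isCutoff_cutoff.integrable_mul fun _ hx => contDiffAt_zero.2
    ⟨{y | y ≠ 0}, isOpen_ne.mem_nhds hx, fun _ hy => (continuousAt_radialExtC f
      hy).continuousWithinAt⟩

theorem norm_radialExtC_le (f : C(Sph n, ℂ)) (x : Cn n) : ‖radialExtC f x‖ ≤ ‖f‖ := by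
  rw [radialExtC]
  split_ifs
  · simp
  · exact f.norm_coe_le_norm _

theorem integrable_cutoff : Integrable (fun x : Cn n => (cutoff (‖x‖ ^ 2) : ℂ)) := by
  simpa using isCutoff_cutoff.integrable_mul (n := n) (h := fun _ => 1)
    fun _ _ => contDiffAt_const

/-- Up to a positive constant, integration over the sphere: the integral over `ℂⁿ` of the radial
extension against a fixed radial weight. -/
def sphIntegral (n : ℕ) : C(Sph n, ℂ) →L[ℂ] ℂ :=
  LinearMap.mkContinuous
    { toFun := fun f => ∫ x : Cn n, (cutoff (‖x‖ ^ 2) : ℂ) * radialExtC f x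
      map_add' := fun f g => by
        rw [← integral_add (integrable_cutoff_radialExtC f) (integrable_cutoff_radialExtC g)]
        congr with x
        rw [← mul_add]
        congr 1
        simp only [radialExtC]
        split_ifs <;> simp
      map_smul' := fun c f => by
        rw [RingHom.id_apply, smul_eq_mul, ← integral_const_mul]
        congr with x
        rw [mul_left_comm]
        congr 1
        simp only [radialExtC]
        split_ifs <;> simp }
    (∫ x : Cn n, ‖(cutoff (‖x‖ ^ 2) : ℂ)‖) fun f => by
      rw [← integral_mul_const]
      refine norm_integral_le_of_norm_le (integrable_cutoff.norm.mul_const _)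
        (.of_forall fun x => ?_)
      rw [norm_mul]
      exact mul_le_mul_of_nonneg_left (norm_radialExtC_le f x) (norm_nonneg _)

theorem sphIntegral_apply (f : C(Sph n, ℂ)) :
    sphIntegral n f = ∫ x : Cn n, (cutoff (‖x‖ ^ 2) : ℂ) * radialExtC f x := rfl

theorem eq_zero_of_sphIntegral_mul_star {f : C(Sph n, ℂ)} (h : sphIntegral n (f * star f) = 0) :
    f = 0 := by
  by_contra hf
  obtain ⟨u, hu⟩ := DFunLike.ne_iff.1 hf
  have hcont : Continuous (fun x : Cn n => cutoff (‖x‖ ^ 2) * ‖radialExtC f x‖ ^ 2) := by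
    have : Continuous fun x : Cn n => (cutoff (‖x‖ ^ 2) : ℂ) *
      ((‖radialExtC f x‖ ^ 2 : ℝ) : ℂ) := by
      refine (isCutoff_cutoff.contDiff_mul (k := 0) fun x hx => contDiffAt_zero.2
        ⟨{y | y ≠ 0}, isOpen_ne.mem_nhds hx, fun y hy => ?_⟩).continuous
      have := continuousAt_radialExtC f hy
      exact ContinuousAt.continuousWithinAt (by fun_prop)
    have h2 := Complex.continuous_re.comp this
    refine h2.congr fun x => ?_
    rw [Function.comp_apply, ← Complex.ofReal_mul, Complex.ofReal_re]
  have hpos := hcont.integral_pos_of_hasCompactSupport_nonneg_nonzero (μ := volume)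
    (x := (u : Cn n))
    (by
      refine HasCompactSupport.intro (isCompact_closedBall (0 : Cn n) 2) fun x hx => ?_
      have : (2 : ℝ) < ‖x‖ := by simpa using hx
      rw [isCutoff_cutoff.eq_zero_of_ge _ (by nlinarith), zero_mul])
    (fun x => mul_nonneg (cutoff_nonneg _) (by positivity))
    (by
      rw [radialExtC_coe, norm_eq_of_mem_sphere]
      simpa [cutoff_one] using hu)
  have : sphIntegral n (f * star f) =
    ((∫ x : Cn n, cutoff (‖x‖ ^ 2) * ‖radialExtC f x‖ ^ 2 : ℝ) : ℂ) := by
    rw [sphIntegral_apply, ← integral_complex_ofReal]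
    congr with x
    push_cast
    rw [← Complex.mul_conj']
    congr 1
    simp only [radialExtC]
    split_ifs <;> simp
  rw [this] at h
  exact hpos.ne' (by exact_mod_cast h)

/-! ### Coordinate functions and bihomogeneous functions -/

/-- The coordinate `z_j` as a real-linear functional. -/
def coordCLM (j : Fin n) : Cn n →L[ℝ] ℂ :=
  (EuclideanSpace.proj j : Cn n →L[ℂ] ℂ).restrictScalars ℝ

/-- The functionals `z_j` (`Sum.inl j`) and `z̄_j` (`Sum.inr j`). -/
def zCoord (n : ℕ) : Fin n ⊕ Fin n → Cn n →L[ℝ] ℂ :=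
  Sum.elim coordCLM fun j => (Complex.conjCLE : ℂ →L[ℝ] ℂ) ∘L coordCLM j

/-- The functionals `x_j` (`Sum.inl j`) and `y_j` (`Sum.inr j`). -/
def xyCoord (n : ℕ) : Fin n ⊕ Fin n → Cn n →L[ℝ] ℂ :=
  Sum.elim (fun j => (Complex.ofRealCLM ∘L Complex.reCLM) ∘L coordCLM j)
    fun j => (Complex.ofRealCLM ∘L Complex.imCLM) ∘L coordCLM j

@[simp] theorem zCoord_inl (j : Fin n) (z : Cn n) : zCoord n (Sum.inl j) z = z j := rfl

@[simp] theorem zCoord_inr (j : Fin n) (z : Cn n) : zCoord n (Sum.inr j) z = conj (z j) := rfl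

theorem polyVal_eq (P : MvPolynomial (Fin n ⊕ Fin n) ℂ) (z : Cn n) :
    polyVal P z = MvPolynomial.eval (fun s => xyCoord n s z) P := by
  rw [polyVal]
  congr 2
  ext s
  rcases s with j | j <;> rfl

theorem sum_cnBasis {M : Type*} [AddCommMonoid M] (f : Cn n → M) :
    ∑ i, f (cnBasis n i) = ∑ k : Fin n, (f (EuclideanSpace.single k 1)
      + f (EuclideanSpace.single k Complex.I)) := by
  rw [Fintype.sum_sigma]
  refine Finset.sum_congr rfl fun k _ => ?_
  rw [Fin.sum_univ_two]
  congr 2 <;> simp [cnBasis]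

theorem gram_xyCoord (s t : Fin n ⊕ Fin n) :
    ∑ i, xyCoord n s (cnBasis n i) * xyCoord n t (cnBasis n i) = if s = t then 1 else 0 := by
  rw [sum_cnBasis fun v => xyCoord n s v * xyCoord n t v]
  rcases s with j | j <;> rcases t with k | k <;>
    simp [xyCoord, coordCLM, apply_ite, eq_comm]

theorem laplacian_polyVal (P : MvPolynomial (Fin n ⊕ Fin n) ℂ) (hP : IsHarmonicPoly P) (x : Cn n) :
    Δ (polyVal P) x = 0 := by
  have h : polyVal P = fun z => MvPolynomial.eval (fun s => xyCoord n s z) P :=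
    funext fun z => polyVal_eq P z
  rw [h, laplacian_eval (cnBasis n)]
  simp only [gram_xyCoord, ite_mul, one_mul, zero_mul, Finset.sum_ite_eq, Finset.mem_univ, if_true]
  rw [← map_sum, hP, map_zero]

/-- `P (w z) = w ^ k * w̄ ^ l * P z` for all `w ∈ ℂ` and `z ∈ ℂⁿ`. -/
def IsBihomogeneous (k l : ℕ) (P : Cn n → ℂ) : Prop :=
  ∀ (w : ℂ) (z : Cn n), P (w • z) = w ^ k * conj w ^ l * P z

theorem IsBihomogeneous.real_smul {k l : ℕ} {P : Cn n → ℂ} (hP : IsBihomogeneous k l P) (r : ℝ)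
    (z : Cn n) : P (r • z) = (r : ℂ) ^ (k + l) * P z := by
  have h := hP r z
  rw [Complex.conj_ofReal, ← pow_add] at h
  rw [← h]
  rfl

theorem IsBihomogeneous.rot_smul {k l : ℕ} {P : Cn n → ℂ} (hP : IsBihomogeneous k l P) (t : ℝ)
    (z : Cn n) : P (Complex.exp (t * Complex.I) • z)
      = Complex.exp (t * (((k : ℂ) - l) * Complex.I)) * P z := by
  rw [hP, ← Complex.exp_conj, ← Complex.exp_nat_mul, ← Complex.exp_nat_mul, ← Complex.exp_add]
  congr 2
  simp
  ring

theorem radialExtC_restrict (P : Cn n → ℂ) {x : Cn n} (hx : x ≠ 0) :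
    radialExtC (fun u : Sph n => P u) x = P (‖x‖⁻¹ • x) := by
  rw [radialExtC, dif_neg hx]

theorem rotDeriv_of_weight {F : Cn n → ℂ} {x : Cn n} (hF : DifferentiableAt ℝ F x) (c : ℂ)
    (h : ∀ t : ℝ, F (Complex.exp (t * Complex.I) • x) = Complex.exp (t * c) * F x) :
    rotDeriv F x = c * F x := by
  have h1 := hasDerivAt_rot_comp hF
  simp only [h] at h1
  have h2 : HasDerivAt (fun t : ℝ => Complex.exp (t * c)) c 0 := by
    have := ((Complex.ofRealCLM.hasDerivAt (x := (0 : ℝ))).mul_const c).cexp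
    simp only [Complex.ofRealCLM_apply, Complex.ofReal_zero, zero_mul, Complex.exp_zero,
      Complex.ofReal_one, one_mul] at this
    exact this
  exact h1.unique (h2.mul_const _)

theorem rotDeriv_rotDeriv_radialExtC {k l : ℕ} {P : Cn n → ℂ} [NeZero n]
    (hP : IsBihomogeneous k l P)
    (hc : ContDiff ℝ 2 P) (u : Sph n) :
    rotDeriv (rotDeriv (radialExtC fun u : Sph n => P u)) u = -((k : ℂ) - l) ^ 2 * P u := by
  have hF := isRadiallyConstant_radialExtC (isC2_restrict (n := n) hc)
  set F := radialExtC fun u : Sph n => P u with hFdef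
  have hd : ∀ x : Cn n, x ≠ 0 → DifferentiableAt ℝ F x := fun x hx =>
    (hF.2 x hx).differentiableAt (by norm_num)
  have h1 : ∀ x : Cn n, x ≠ 0 → rotDeriv F x = ((k : ℂ) - l) * Complex.I * F x := by
    intro x hx
    refine rotDeriv_of_weight (hd x hx) _ fun t => ?_
    rw [hFdef, radialExtC_restrict _ hx, radialExtC_restrict _ (smul_ne_zero
      (Complex.exp_ne_zero _) hx),
      norm_smul, Complex.norm_exp_ofReal_mul_I, one_mul, smul_comm, hP.rot_smul]
  have h2 : rotDeriv F =ᶠ[nhds (u : Cn n)] fun x => ((k : ℂ) - l) * Complex.I * F x := by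
    filter_upwards [isOpen_ne.mem_nhds (coe_sph_ne_zero u)] with x hx using h1 x hx
  have h3 := h1 u (coe_sph_ne_zero u)
  rw [rotDeriv, h2.fderiv_eq, fderiv_const_mul (hd u (coe_sph_ne_zero u)), smul_apply]
  rw [rotDeriv] at h3
  rw [h3, hFdef, radialExtC_coe, smul_eq_mul]
  linear_combination (((k : ℂ) - l) ^ 2 * P u) * Complex.I_sq

/-- The Laplacian on the sphere of the restriction of a bihomogeneous function. Near the sphere `P =
‖·‖ ^ (k + l) * F` with `F` constant along rays, and in `Δ(‖·‖ ^ (k + l) * F)` the cross term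
vanishes by Euler's relation for `F`. -/
theorem laplacian_radialExtC {k l : ℕ} {P : Cn n → ℂ} [NeZero n] (hP : IsBihomogeneous k l P)
    (hc : ContDiff ℝ 2 P) (u : Sph n) :
    Δ (radialExtC fun u : Sph n => P u) (u : Cn n)
      = Δ P u - ((k : ℂ) + l) * ((k : ℂ) + l + 2 * n - 2) * P u := by
  have hF := isRadiallyConstant_radialExtC (isC2_restrict (n := n) hc)
  have hF1 : IsRadiallyConstant 1 _ := ⟨hF.1, fun x hx => (hF.2 x hx).of_le (by norm_num)⟩
  have hu := coe_sph_ne_zero u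
  have hn := norm_eq_of_mem_sphere u
  set F := radialExtC fun u : Sph n => P u with hFdef
  set s : ℝ := ((k + l : ℕ) : ℝ) / 2
  have hR : ContDiffAt ℝ 2 (fun y : Cn n => (‖y‖ ^ 2) ^ s) u :=
    (contDiff_norm_sq ℝ).contDiffAt.rpow_const_of_ne (by simp)
  have hRC : ContDiffAt ℝ 2 (fun y : Cn n => (((‖y‖ ^ 2) ^ s : ℝ) : ℂ)) u :=
    Complex.ofRealCLM.contDiff.contDiffAt.comp _ hR
  have hlapR : Δ (fun y : Cn n => (((‖y‖ ^ 2) ^ s : ℝ) : ℂ)) (u : Cn n)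
      = ((2 * s * (2 * s + Fintype.card (Σ _ : Fin n, Fin 2) - 2) : ℝ) : ℂ) := by
    rw [← laplacian_norm_sq_rpow (cnBasis n) s hn]
    exact hR.laplacian_CLM_comp_left (l := Complex.ofRealCLM)
  have hfd : ∀ v, fderiv ℝ (fun y : Cn n => (((‖y‖ ^ 2) ^ s : ℝ) : ℂ)) u v
      = ((2 * s : ℝ) : ℂ) * ((inner ℝ (u : Cn n) v : ℝ) : ℂ) := by
    intro v
    have := (Complex.ofRealCLM.hasFDerivAt).comp (u : Cn n) (hasFDerivAt_norm_sq_rpow s hu)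
    have h2 : fderiv ℝ (fun y : Cn n => (((‖y‖ ^ 2) ^ s : ℝ) : ℂ)) u = _ := this.fderiv
    rw [h2]
    simp [hn]
  have hev : P =ᶠ[nhds (u : Cn n)] fun y => (((‖y‖ ^ 2) ^ s : ℝ) : ℂ) * F y := by
    filter_upwards [isOpen_ne.mem_nhds hu] with y hy
    rw [hFdef, radialExtC_restrict _ hy, hP.real_smul]
    have : (‖y‖ ^ 2) ^ s = ‖y‖ ^ (k + l) := by
      rw [← Real.rpow_natCast, ← Real.rpow_mul (norm_nonneg _), ← Real.rpow_natCast]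
      congr 1
      simp only [s]
      push_cast
      ring
    rw [this, ← mul_assoc]
    push_cast
    rw [← mul_pow, mul_inv_cancel₀ (by simpa using hy), one_pow, one_mul]
  -- The derivative of a power of the norm is radial, so Euler's relation for `F` applies.
  have hcross : ∑ i, fderiv ℝ (fun y : Cn n => (((‖y‖ ^ 2) ^ s : ℝ) : ℂ)) u (cnBasis n i)
      * fderiv ℝ F u (cnBasis n i) = 0 := by
    have h := hF1.fderiv_self hu
    rw [← (cnBasis n).sum_repr' (u : Cn n), map_sum, (cnBasis n).sum_repr' (u : Cn n)] at h
    simp only [hfd, mul_assoc]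
    rw [← Finset.mul_sum]
    simp only [map_smul, Complex.real_smul] at h
    simp only [real_inner_comm (cnBasis n _), h, mul_zero]
  have h := (InnerProductSpace.laplacian_congr_nhds hev).eq_of_nhds
  rw [laplacian_mul (cnBasis n) hRC (hF.2 u hu), hcross, hlapR, hn, hFdef, radialExtC_coe, ← hFdef]
    at h
  rw [h]
  simp [s]
  ring

theorem extOp_radialExtC {k l : ℕ} {P : Cn n → ℂ} [NeZero n] (α β γ : ℝ)
    (hP : IsBihomogeneous k l P)
    (hc : ContDiff ℝ 2 P) (u : Sph n) :
    extOp α β γ (radialExtC fun u : Sph n => P u) (u : Cn n)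
      = (γ - α * ((k : ℂ) - l) ^ 2 - β * (((k : ℂ) + l) * ((k : ℂ) + l + 2 * n - 2))) * P u
        + β * Δ P u := by
  rw [extOp, rotDeriv_rotDeriv_radialExtC hP hc, laplacian_radialExtC hP hc, radialExtC_coe,
    norm_eq_of_mem_sphere]
  push_cast
  ring

/-! ### Density of the polynomials in `z` and `z̄` -/

/-- The restriction to the sphere of a polynomial in `z` (variables `Sum.inl j`) and `z̄` (variables
`Sum.inr j`). -/
def restrictPoly (n : ℕ) : MvPolynomial (Fin n ⊕ Fin n) ℂ →ₐ[ℂ] C(Sph n, ℂ) :=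
  MvPolynomial.aeval fun s =>
    ⟨fun u => zCoord n s (u : Cn n), (zCoord n s).continuous.comp continuous_subtype_val⟩

theorem restrictPoly_apply (q : MvPolynomial (Fin n ⊕ Fin n) ℂ) (u : Sph n) :
    restrictPoly n q u = MvPolynomial.eval (fun s => zCoord n s (u : Cn n)) q := by
  induction q using MvPolynomial.induction_on with
  | C a => simp [restrictPoly]
  | add p q hp hq => simp [hp, hq]
  | mul_X p i hp =>
    rw [map_mul, map_mul, ContinuousMap.mul_apply, hp, MvPolynomial.eval_X, restrictPoly,
      MvPolynomial.aeval_X]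
    rfl

theorem restrictPoly_monomial (e : (Fin n ⊕ Fin n) →₀ ℕ) (a : ℂ) :
    restrictPoly n (MvPolynomial.monomial e a)
      = a • restrictPoly n (MvPolynomial.monomial e 1) := by
  rw [← map_smul, MvPolynomial.smul_monomial, smul_eq_mul, mul_one]

theorem star_restrictPoly_X (s : Fin n ⊕ Fin n) :
    star (restrictPoly n (MvPolynomial.X s)) = restrictPoly n (MvPolynomial.X s.swap) := by
  ext u
  rw [ContinuousMap.star_apply, restrictPoly_apply, restrictPoly_apply]
  rcases s with j | j <;> simp

theorem topologicalClosure_adjoin_coord :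
    (StarAlgebra.adjoin ℂ (Set.range fun s => restrictPoly n (MvPolynomial.X s))).topologicalClosure
      = ⊤ := by
  refine ContinuousMap.starSubalgebra_topologicalClosure_eq_top_of_separatesPoints _ ?_
  intro u v huv
  have h : ∃ j, (u : Cn n) j ≠ (v : Cn n) j := by
    by_contra! h
    exact huv (Subtype.ext (PiLp.ext h))
  obtain ⟨j, hj⟩ := h
  refine ⟨_, ⟨restrictPoly n (MvPolynomial.X (Sum.inl j)),
    StarAlgebra.subset_adjoin _ _ ⟨_, rfl⟩, rfl⟩, ?_⟩
  simpa [restrictPoly_apply] using hj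

theorem mem_range_of_mem_adjoin {f : C(Sph n, ℂ)}
    (hf : f ∈ StarAlgebra.adjoin ℂ (Set.range fun s => restrictPoly n (MvPolynomial.X s))) :
    f ∈ (restrictPoly n).range := by
  rw [← StarSubalgebra.mem_toSubalgebra, StarAlgebra.adjoin_toSubalgebra] at hf
  refine Algebra.adjoin_le ?_ hf
  rintro g (⟨s, rfl⟩ | ⟨s, hs⟩)
  · exact ⟨_, rfl⟩
  · refine ⟨MvPolynomial.X s.swap, ?_⟩
    have : g = star (restrictPoly n (MvPolynomial.X s)) := by
      rw [← star_star g]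
      exact congrArg star hs.symm
    rw [this, star_restrictPoly_X]
    rfl

/-- A continuous function orthogonal to all monomials vanishes, by the Stone-Weierstrass theorem. -/
theorem eq_zero_of_orthogonal {f : C(Sph n, ℂ)}
    (h : ∀ e, sphIntegral n (f * restrictPoly n (MvPolynomial.monomial e 1)) = 0) : f = 0 := by
  have h1 : ∀ q, sphIntegral n (f * restrictPoly n q) = 0 := by
    intro q
    induction q using MvPolynomial.induction_on' with
    | monomial e a =>
      rw [restrictPoly_monomial, mul_smul_comm, map_smul, h, smul_zero]
    | add p q hp hq => rw [map_add, mul_add, map_add, hp, hq, add_zero]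
  let Λ : C(Sph n, ℂ) →L[ℂ] ℂ := (sphIntegral n).comp (ContinuousLinearMap.mul ℂ _ f)
  have h2 : star f ∈ closure
      (StarAlgebra.adjoin ℂ (Set.range fun s => restrictPoly n (MvPolynomial.X s)) : Set _) := by
    rw [← StarSubalgebra.topologicalClosure_coe, topologicalClosure_adjoin_coord]
    trivial
  -- The functional `g ↦ ∫ f g` vanishes on polynomials, hence on their closure.
  have h3 : closure
      (StarAlgebra.adjoin ℂ (Set.range fun s => restrictPoly n (MvPolynomial.X s)) : Set _)
      ⊆ {g | Λ g = 0} := by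
    refine closure_minimal (fun g hg => ?_) (isClosed_eq Λ.continuous continuous_const)
    obtain ⟨q, rfl⟩ := mem_range_of_mem_adjoin hg
    exact h1 q
  exact eq_zero_of_sphIntegral_mul_star (h3 h2)

/-! ### The weak eigenvalue equation on monomials -/

/-- The euclidean Laplacian on polynomials in `z` and `z̄`. It lowers the degree by two. -/
def polyLaplacian (q : MvPolynomial (Fin n ⊕ Fin n) ℂ) : MvPolynomial (Fin n ⊕ Fin n) ℂ :=
  ∑ s, ∑ t, (∑ i, zCoord n s (cnBasis n i) * zCoord n t (cnBasis n i)) •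
    MvPolynomial.pderiv t (MvPolynomial.pderiv s q)

theorem laplacian_eval_zCoord (q : MvPolynomial (Fin n ⊕ Fin n) ℂ) (x : Cn n) :
    Δ (fun z => MvPolynomial.eval (fun s => zCoord n s z) q) x
      = MvPolynomial.eval (fun s => zCoord n s x) (polyLaplacian q) := by
  rw [laplacian_eval (cnBasis n)]
  simp [polyLaplacian, MvPolynomial.smul_eval]

/-- The degree of a monomial in the variables `z_j`. -/
def holDegree (e : (Fin n ⊕ Fin n) →₀ ℕ) : ℕ := ∑ j, e (Sum.inl j)

/-- The degree of a monomial in the variables `z̄_j`. -/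
def antiholDegree (e : (Fin n ⊕ Fin n) →₀ ℕ) : ℕ := ∑ j, e (Sum.inr j)

theorem isBihomogeneous_monomial (e : (Fin n ⊕ Fin n) →₀ ℕ) :
    IsBihomogeneous (holDegree e) (antiholDegree e)
      (fun z => MvPolynomial.eval (fun s => zCoord n s z) (MvPolynomial.monomial e 1)) := by
  intro w z
  simp only [MvPolynomial.eval_monomial, Finsupp.prod_fintype _ _ (fun _ => pow_zero _), one_mul,
    Fintype.prod_sum_type, zCoord_inl, zCoord_inr, PiLp.smul_apply, smul_eq_mul, map_mul, mul_pow,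
    Finset.prod_mul_distrib, Finset.prod_pow_eq_pow_sum, holDegree, antiholDegree]
  ring

/-- The eigenvalue of `α JN² + β Δ + γ` on spherical harmonics of bidegree `(k, l)`. -/
def bidegreeEigenvalue (n : ℕ) (α β γ : ℝ) (k l : ℕ) : ℝ :=
  γ - α * ((k : ℝ) - l) ^ 2 - β * (((k : ℝ) + l) * ((k : ℝ) + l + 2 * n - 2))

/-- `f` satisfies `(α JN² + β Δ + γ) f = s f` weakly, tested against all monomials in `z` and `z̄`:
by symmetry the operator is moved to the monomial, where it is triangular. -/
def IsWeakEigen (α β γ s : ℝ) (f : C(Sph n, ℂ)) : Prop :=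
  ∀ e : (Fin n ⊕ Fin n) →₀ ℕ,
    ((s - bidegreeEigenvalue n α β γ (holDegree e) (antiholDegree e) : ℝ) : ℂ)
      * sphIntegral n (f * restrictPoly n (MvPolynomial.monomial e 1))
    = β * sphIntegral n (f * restrictPoly n (polyLaplacian (MvPolynomial.monomial e 1)))

theorem IsWeakEigen.sub {α β γ s : ℝ} {f g : C(Sph n, ℂ)} (hf : IsWeakEigen α β γ s f)
    (hg : IsWeakEigen α β γ s g) : IsWeakEigen α β γ s (f - g) := by
  intro e
  rw [sub_mul, sub_mul, map_sub, map_sub, mul_sub, mul_sub, hf, hg]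

theorem extOp_eq_radialExtC [NeZero n] {α β γ : ℝ} {f g : Sph n → ℂ} (hf : IsC2 f)
    (h : ∀ u : Sph n, extOp α β γ (radialExtC f) u = g u) {x : Cn n} (hx : x ≠ 0) :
    extOp α β γ (radialExtC f) x = radialExtC g x := by
  have hc := inv_pos.2 (norm_pos_iff.2 hx)
  rw [← extOp_smul α β γ (isRadiallyConstant_radialExtC hf) hc hx, radialExtC, dif_neg hx, ← h]

theorem isC2_restrictPoly [NeZero n] (q : MvPolynomial (Fin n ⊕ Fin n) ℂ) :
    IsC2 (restrictPoly n q) := by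
  have := isC2_restrict (n := n) (contDiff_eval (k := 2) (zCoord n) q)
  rwa [show ⇑(restrictPoly n q) = _ from funext fun u => restrictPoly_apply q u]

theorem isWeakEigen_of_extOp [NeZero n] {α β γ s : ℝ} {f : C(Sph n, ℂ)} (hf : IsC2 f)
    (h : ∀ u : Sph n, extOp α β γ (radialExtC f) u = s * f u) : IsWeakEigen α β γ s f := by
  intro e
  set m := restrictPoly n (MvPolynomial.monomial e 1) with hm
  set L := restrictPoly n (polyLaplacian (MvPolynomial.monomial e 1)) with hL
  set lam := bidegreeEigenvalue n α β γ (holDegree e) (antiholDegree e) with hlam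
  have hmC : IsC2 m := isC2_restrictPoly _
  have h2 : ∀ u : Sph n, extOp α β γ (radialExtC m) u = lam * m u + β * L u := by
    intro u
    have := extOp_radialExtC α β γ (isBihomogeneous_monomial e) (contDiff_eval (zCoord n) _) u
    rw [laplacian_eval_zCoord, ← restrictPoly_apply, ← restrictPoly_apply] at this
    simp only [← restrictPoly_apply] at this
    rw [this, hlam, bidegreeEigenvalue]
    push_cast
    rfl
  have key : sphIntegral n (((s - lam : ℝ) : ℂ) • (f * m) - (β : ℂ) • (f * L)) = 0 := by
    rw [← integral_extOp_symm isCutoff_cutoff α β γ (isRadiallyConstant_radialExtC hf)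
      (isRadiallyConstant_radialExtC hmC), sphIntegral_apply]
    congr with x
    by_cases hx : x = 0
    · rw [hx, isCutoff_cutoff.eq_zero_of_le _ (by simp)]; simp
    · rw [extOp_eq_radialExtC hf h hx, extOp_eq_radialExtC hmC h2 hx]
      simp only [radialExtC, dif_neg hx]
      simp
      ring_nf
      simp
  rw [map_sub, map_smul, map_smul, sub_eq_zero] at key
  simpa using key

/-- As the Laplacian lowers the degree, a weak eigenfunction is orthogonal to all monomials if it is
orthogonal to those whose bidegree has eigenvalue `s`. -/
theorem IsWeakEigen.orthogonal {α β γ s : ℝ} {f : C(Sph n, ℂ)} (hf : IsWeakEigen α β γ s f)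
    (h : ∀ e, bidegreeEigenvalue n α β γ (holDegree e) (antiholDegree e) = s →
      sphIntegral n (f * restrictPoly n (MvPolynomial.monomial e 1)) = 0)
    (e : (Fin n ⊕ Fin n) →₀ ℕ) :
    sphIntegral n (f * restrictPoly n (MvPolynomial.monomial e 1)) = 0 := by
  induction hd : e.degree using Nat.strong_induction_on generalizing e with
  | _ d ih =>
    by_cases hs : bidegreeEigenvalue n α β γ (holDegree e) (antiholDegree e) = s
    · exact h e hs
    have h1 := hf e
    have h2 : sphIntegral n (f * restrictPoly n (polyLaplacian
      (MvPolynomial.monomial e 1))) = 0 := by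
      simp only [polyLaplacian, map_sum, map_smul, Finset.mul_sum, mul_smul_comm]
      refine Finset.sum_eq_zero fun a _ => Finset.sum_eq_zero fun b _ => ?_
      rw [MvPolynomial.pderiv_monomial, MvPolynomial.pderiv_monomial, one_mul]
      by_cases ha : e a = 0
      · simp [ha]
      have hlt : (e - Finsupp.single a 1 - Finsupp.single b 1).degree < d := by
        rw [← hd, Finsupp.degree_eq_sum, Finsupp.degree_eq_sum]
        refine Finset.sum_lt_sum (fun i _ => ?_) ⟨a, Finset.mem_univ _, ?_⟩
        · simp only [Finsupp.tsub_apply]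
          omega
        · simp only [Finsupp.tsub_apply, Finsupp.single_eq_same]
          omega
      have := ih _ hlt _ rfl
      rw [restrictPoly_monomial, mul_smul_comm, map_smul, this, smul_zero, smul_zero]
    rw [h2, mul_zero] at h1
    refine (mul_eq_zero.1 h1).resolve_left ?_
    exact_mod_cast sub_ne_zero.2 (Ne.symm hs)

/-- Orthogonal projection to a finite-dimensional subspace on which a bilinear form is
nondegenerate. -/
theorem exists_mem_forall_apply_eq {K V : Type*} [Field K] [AddCommGroup V] [Module K V]
    (B : V →ₗ[K] V →ₗ[K] K) (W : Submodule K V) [FiniteDimensional K W]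
    (hB : ∀ x ∈ W, (∀ y ∈ W, B x y = 0) → x = 0) (f : V) :
    ∃ w ∈ W, ∀ y ∈ W, B w y = B f y := by
  let T : W →ₗ[K] Module.Dual K W := B.domRestrict₁₂ W W
  have hinj : Function.Injective T := (injective_iff_map_eq_zero T).2 fun x hx =>
    Subtype.ext (hB x x.2 fun y hy => LinearMap.congr_fun hx ⟨y, hy⟩)
  obtain ⟨w, hw⟩ := (LinearMap.injective_iff_surjective_of_finrank_eq_finrank
    (Subspace.dual_finrank_eq (K := K) (V := W)).symm).1 hinj ((B f).domRestrict W)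
  exact ⟨w, w.2, fun y hy => LinearMap.congr_fun hw ⟨y, hy⟩⟩

/-- The bilinear form `∫ f g` is nondegenerate on a finite-dimensional subspace closed under complex
conjugation. -/
theorem exists_sub_orthogonal (W : Submodule ℂ C(Sph n, ℂ)) [FiniteDimensional ℂ W]
    (hW : ∀ g ∈ W, star g ∈ W) (f : C(Sph n, ℂ)) :
    ∃ w ∈ W, ∀ g ∈ W, sphIntegral n ((f - w) * g) = 0 := by
  obtain ⟨w, hw, h⟩ := exists_mem_forall_apply_eq
    ((LinearMap.mul ℂ C(Sph n, ℂ)).compr₂ (sphIntegral n : C(Sph n, ℂ) →ₗ[ℂ] ℂ)) W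
    (fun x hx h => eq_zero_of_sphIntegral_mul_star (h _ (hW x hx))) f
  refine ⟨w, hw, fun g hg => ?_⟩
  rw [sub_mul, map_sub, sub_eq_zero]
  exact (h g hg).symm

theorem mem_of_isWeakEigen {α β γ s : ℝ} (W : Submodule ℂ C(Sph n, ℂ)) [FiniteDimensional ℂ W]
    (hstar : ∀ g ∈ W, star g ∈ W) (hW : ∀ g ∈ W, IsWeakEigen α β γ s g)
    (h : ∀ f, IsWeakEigen α β γ s f → (∀ g ∈ W, sphIntegral n (f * g) = 0) →
      ∀ e, bidegreeEigenvalue n α β γ (holDegree e) (antiholDegree e) = s →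
        sphIntegral n (f * restrictPoly n (MvPolynomial.monomial e 1)) = 0)
    {f : C(Sph n, ℂ)} (hf : IsWeakEigen α β γ s f) : f ∈ W := by
  obtain ⟨w, hw, hort⟩ := exists_sub_orthogonal W hstar f
  have hfw := hf.sub (hW w hw)
  have := eq_zero_of_orthogonal (hfw.orthogonal (h _ hfw hort))
  rwa [sub_eq_zero.1 this]

/-! ### Eigenspaces of the operators -/

theorem isC2_add [NeZero n] {f g : Sph n → ℂ} (hf : IsC2 f) (hg : IsC2 g) : IsC2 (f + g) :=
  ContMDiff.add hf hg

theorem isC2_smul [NeZero n] (c : ℂ) {f : Sph n → ℂ} (hf : IsC2 f) : IsC2 (c • f) :=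
  (ContinuousLinearMap.mul ℝ ℂ c).contMDiff.comp hf

theorem radialExtC_linear (c : ℂ) (f g : Sph n → ℂ) :
    radialExtC (c • f + g) = fun x => c * radialExtC f x + radialExtC g x := by
  ext x
  simp only [radialExtC]
  split_ifs <;> simp

theorem extOp_linear {F G : Cn n → ℂ} (α β γ : ℝ) (hF : IsRadiallyConstant 2 F)
    (hG : IsRadiallyConstant 2 G) (c : ℂ) {x : Cn n} (hx : x ≠ 0) :
    extOp α β γ (fun x => c * F x + G x) x = c * extOp α β γ F x + extOp α β γ G x := by
  have hr : ∀ {H K : Cn n → ℂ} {y : Cn n}, DifferentiableAt ℝ H y → DifferentiableAt ℝ K y →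
      rotDeriv (fun x => c * H x + K x) y = c * rotDeriv H y + rotDeriv K y := by
    intro H K y h1 h2
    rw [rotDeriv, fderiv_fun_add (h1.const_mul c) h2, fderiv_const_mul h1]
    simp [rotDeriv]
  have hd {k : ℕ∞ω} {H : Cn n → ℂ} (hH : IsRadiallyConstant k H) (hk : k ≠ 0) {y : Cn n}
      (hy : y ≠ 0) : DifferentiableAt ℝ H y := (hH.2 y hy).differentiableAt hk
  have h1 : rotDeriv (fun x => c * F x + G x) =ᶠ[nhds x]
      fun x => c * rotDeriv F x + rotDeriv G x := by
    filter_upwards [isOpen_ne.mem_nhds hx] with y hy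
    exact hr (hd hF two_ne_zero hy) (hd hG two_ne_zero hy)
  have h2 : rotDeriv (rotDeriv (fun x => c * F x + G x)) x
      = c * rotDeriv (rotDeriv F) x + rotDeriv (rotDeriv G) x := by
    rw [← hr (hd hF.rotDeriv one_ne_zero hx) (hd hG.rotDeriv one_ne_zero hx), rotDeriv,
      h1.fderiv_eq, ← rotDeriv]
  have h3 : Δ (fun x => c * F x + G x) x = c * Δ F x + Δ G x := by
    have := (contDiffAt_const.mul (hF.2 x hx) : ContDiffAt ℝ 2 (fun y => c * F y) x).laplacian_add
      (hG.2 x hx)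
    have h4 := InnerProductSpace.laplacian_smul c (hF.2 x hx)
    simp only [smul_eq_mul] at h4
    rw [← h4]
    exact this
  rw [extOp, h2, h3, extOp, extOp]
  ring

section
variable [NeZero n] {D : (Sph n → ℝ) → Sph n → ℝ} {α β γ : ℝ}

theorem smul_add_mem_eigenfunctions
    (hD : ∀ f u, D f u = α * JN (JN f) u + β * sphLaplacian f u + γ * f u) {s : ℝ} (c : ℂ)
    {f g : Sph n → ℂ} (hf : f ∈ eigenfunctions (complexify D) s)
    (hg : g ∈ eigenfunctions (complexify D) s) :
    c • f + g ∈ eigenfunctions (complexify D) s := by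
  have hc : IsC2 (c • f + g) := isC2_add (isC2_smul c hf.1) hg.1
  refine ⟨hc, fun u => ?_⟩
  have h := hf.2 u
  have h' := hg.2 u
  rw [complexify_eq_extOp hD hf.1] at h
  rw [complexify_eq_extOp hD hg.1] at h'
  rw [complexify_eq_extOp hD hc, radialExtC_linear, extOp_linear α β γ
    (isRadiallyConstant_radialExtC hf.1)
    (isRadiallyConstant_radialExtC hg.1) _ (coe_sph_ne_zero u), h, h']
  simp only [Pi.add_apply, Pi.smul_apply, smul_eq_mul]
  ring

theorem zero_mem_eigenfunctions
    (hD : ∀ f u, D f u = α * JN (JN f) u + β * sphLaplacian f u + γ * f u) (s : ℝ) :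
    (0 : Sph n → ℂ) ∈ eigenfunctions (complexify D) s := by
  have h0 : radialExtC (0 : Sph n → ℂ) = fun _ => 0 := by ext x; simp [radialExtC]
  have hc : IsC2 (0 : Sph n → ℂ) := contMDiff_const
  refine ⟨hc, fun u => ?_⟩
  have hF := isRadiallyConstant_radialExtC hc
  have := extOp_linear α β γ hF hF 1 (coe_sph_ne_zero u)
  rw [complexify_eq_extOp hD hc]
  simpa [h0] using this

/-- The eigenspace of the complexified operator, as a complex subspace. -/
def eigenSubmodule (hD : ∀ f u, D f u = α * JN (JN f) u + β * sphLaplacian f u + γ * f u) (s : ℝ) :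
    Submodule ℂ (Sph n → ℂ) where
  carrier := eigenfunctions (complexify D) s
  zero_mem' := zero_mem_eigenfunctions hD s
  add_mem' hf hg := by simpa using smul_add_mem_eigenfunctions hD 1 hf hg
  smul_mem' c _ hf := by
    simpa using smul_add_mem_eigenfunctions hD c hf (zero_mem_eigenfunctions hD s)

theorem harm_le_eigenSubmodule
    (hD : ∀ f u, D f u = α * JN (JN f) u + β * sphLaplacian f u + γ * f u) (k l : ℕ) :
    harm n k l ≤ eigenSubmodule hD (bidegreeEigenvalue n α β γ k l) := by
  rintro f ⟨P, hP, hb, hf⟩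
  have hb' : IsBihomogeneous k l (polyVal P : Cn n → ℂ) := hb
  have hc : ContDiff ℝ 2 (polyVal P : Cn n → ℂ) := by
    rw [show (polyVal P : Cn n → ℂ) = _ from funext fun z => polyVal_eq P z]
    exact contDiff_eval _ _
  obtain rfl : f = fun u : Sph n => polyVal P (u : Cn n) := funext hf
  refine ⟨isC2_restrict hc, fun u => ?_⟩
  rw [complexify_eq_extOp hD (isC2_restrict hc), extOp_radialExtC α β γ hb' hc,
    laplacian_polyVal P hP, bidegreeEigenvalue]
  push_cast
  ring

/-- If the functions `g i` are eigenfunctions whose span is closed under conjugation, and if every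
weak eigenfunction orthogonal to them is orthogonal to the monomials whose bidegree has eigenvalue
`s`, then they span the eigenspace. -/
theorem eigenfunctions_eq_span
    (hD : ∀ f u, D f u = α * JN (JN f) u + β * sphLaplacian f u + γ * f u) (s : ℝ)
    {ι : Type*} [Finite ι] (g : ι → C(Sph n, ℂ))
    (hstar : ∀ i, star (g i) ∈ Submodule.span ℂ (Set.range g))
    (hg : ∀ i, ⇑(g i) ∈ eigenSubmodule hD s)
    (h : ∀ f, IsWeakEigen α β γ s f → (∀ i, sphIntegral n (f * g i) = 0) →
      ∀ e, bidegreeEigenvalue n α β γ (holDegree e) (antiholDegree e) = s →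
        sphIntegral n (f * restrictPoly n (MvPolynomial.monomial e 1)) = 0) :
    eigenfunctions (complexify D) s = Submodule.span ℂ (Set.range fun i => ⇑(g i)) := by
  have hmap : Submodule.span ℂ (Set.range fun i => ⇑(g i))
      = (Submodule.span ℂ (Set.range g)).map (ContinuousMap.coeFnLinearMap ℂ) := by
    rw [Submodule.map_span, ← Set.range_comp]
    rfl
  have hle : Submodule.span ℂ (Set.range fun i => ⇑(g i)) ≤ eigenSubmodule hD s :=
    Submodule.span_le.2 (Set.range_subset_iff.2 hg)
  have hweak : ∀ f : C(Sph n, ℂ), ⇑f ∈ eigenSubmodule hD s → IsWeakEigen α β γ s f := by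
    rintro f ⟨hc, hf⟩
    refine isWeakEigen_of_extOp hc fun u => ?_
    rw [← complexify_eq_extOp hD hc, hf]
  refine Set.Subset.antisymm (fun f hf => ?_) hle
  rw [hmap]
  have hfc : Continuous f := ContMDiff.continuous hf.1
  have : FiniteDimensional ℂ (Submodule.span ℂ (Set.range g)) :=
    FiniteDimensional.span_of_finite ℂ (Set.finite_range g)
  refine ⟨⟨f, hfc⟩, ?_, rfl⟩
  refine mem_of_isWeakEigen (α := α) (β := β) (γ := γ) (s := s) _ (fun x hx => ?_) (fun x hx => ?_)
    (fun f' hf' hort => h f' hf' fun i => hort _ (Submodule.subset_span (Set.mem_range_self i)))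
    (hweak ⟨f, hfc⟩ hf)
  · induction hx using Submodule.span_induction with
    | mem x hx => obtain ⟨i, rfl⟩ := hx; exact hstar i
    | zero => simp
    | add x y _ _ hx hy => rw [star_add]; exact add_mem hx hy
    | smul c x _ hx => rw [star_smul]; exact Submodule.smul_mem _ _ hx
  · exact hweak x (hle (hmap.symm ▸ Submodule.mem_map_of_mem hx))
end

/-! ### Monomials of low degree and explicit spherical harmonics -/

theorem exists_eq_single_of_sum_eq_one {a : Fin n → ℕ} (h : ∑ j, a j = 1) :
    ∃ j, ∀ i, a i = if j = i then 1 else 0 := by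
  obtain ⟨j, -, hj⟩ := Finset.exists_ne_zero_of_sum_ne_zero (h ▸ one_ne_zero)
  have h1 := Finset.add_sum_erase Finset.univ a (Finset.mem_univ j)
  have h2 : ∑ i ∈ Finset.univ.erase j, a i = 0 := by omega
  refine ⟨j, fun i => ?_⟩
  split_ifs with hij
  · subst hij; omega
  · exact Finset.sum_eq_zero_iff.1 h2 i (Finset.mem_erase.2 ⟨Ne.symm hij, Finset.mem_univ _⟩)

theorem restrictPoly_monomial_zero_zero {e : (Fin n ⊕ Fin n) →₀ ℕ} (h : holDegree e = 0)
    (h' : antiholDegree e = 0) : restrictPoly n (MvPolynomial.monomial e 1) = 1 := by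
  have : e = 0 := by
    ext s
    rcases s with j | j
    · exact Finset.sum_eq_zero_iff.1 h j (Finset.mem_univ _)
    · exact Finset.sum_eq_zero_iff.1 h' j (Finset.mem_univ _)
  rw [this]
  exact map_one _

theorem restrictPoly_monomial_one_zero {e : (Fin n ⊕ Fin n) →₀ ℕ} (h : holDegree e = 1)
    (h' : antiholDegree e = 0) : ∃ j, restrictPoly n (MvPolynomial.monomial e 1)
      = restrictPoly n (MvPolynomial.X (Sum.inl j)) := by
  obtain ⟨j, hj⟩ := exists_eq_single_of_sum_eq_one h
  refine ⟨j, congrArg _ (congrArg (fun e => MvPolynomial.monomial e 1) (?_ :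
    e = Finsupp.single (Sum.inl j) 1))⟩
  ext s
  rcases s with i | i
  · simp [hj, Finsupp.single_apply]
  · simpa [Finsupp.single_apply] using Finset.sum_eq_zero_iff.1 h' i (Finset.mem_univ _)

theorem restrictPoly_monomial_zero_one {e : (Fin n ⊕ Fin n) →₀ ℕ} (h : holDegree e = 0)
    (h' : antiholDegree e = 1) : ∃ j, restrictPoly n (MvPolynomial.monomial e 1)
      = restrictPoly n (MvPolynomial.X (Sum.inr j)) := by
  obtain ⟨j, hj⟩ := exists_eq_single_of_sum_eq_one h'
  refine ⟨j, congrArg _ (congrArg (fun e => MvPolynomial.monomial e 1) (?_ :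
    e = Finsupp.single (Sum.inr j) 1))⟩
  ext s
  rcases s with i | i
  · simpa [Finsupp.single_apply] using Finset.sum_eq_zero_iff.1 h i (Finset.mem_univ _)
  · simp [hj, Finsupp.single_apply]

theorem restrictPoly_monomial_one_one {e : (Fin n ⊕ Fin n) →₀ ℕ} (h : holDegree e = 1)
    (h' : antiholDegree e = 1) : ∃ j k, restrictPoly n (MvPolynomial.monomial e 1)
      = restrictPoly n (MvPolynomial.X (Sum.inl j) * MvPolynomial.X (Sum.inr k)) := by
  obtain ⟨j, hj⟩ := exists_eq_single_of_sum_eq_one h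
  obtain ⟨k, hk⟩ := exists_eq_single_of_sum_eq_one h'
  refine ⟨j, k, congrArg _ ?_⟩
  have : e = Finsupp.single (Sum.inl j) 1 + Finsupp.single (Sum.inr k) 1 := by
    ext s
    rcases s with i | i <;> simp [hj, hk, Finsupp.single_apply]
  rw [this, MvPolynomial.X, MvPolynomial.X, MvPolynomial.monomial_mul, mul_one]

/-- The coordinate `z_j = x_j + i y_j` as a polynomial in `x` and `y`. -/
def zPoly (j : Fin n) : MvPolynomial (Fin n ⊕ Fin n) ℂ :=
  MvPolynomial.X (Sum.inl j) + MvPolynomial.C Complex.I * MvPolynomial.X (Sum.inr j)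

/-- The conjugate coordinate `z̄_j = x_j - i y_j` as a polynomial in `x` and `y`. -/
def zbarPoly (j : Fin n) : MvPolynomial (Fin n ⊕ Fin n) ℂ :=
  MvPolynomial.X (Sum.inl j) - MvPolynomial.C Complex.I * MvPolynomial.X (Sum.inr j)

theorem polyVal_zPoly (j : Fin n) (z : Cn n) : polyVal (zPoly j) z = z j := by
  simp [polyVal, zPoly, mul_comm Complex.I, Complex.re_add_im]

theorem polyVal_zbarPoly (j : Fin n) (z : Cn n) : polyVal (zbarPoly j) z = conj (z j) := by
  apply Complex.ext <;> simp [polyVal, zbarPoly]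

theorem pderiv_zPoly (s : Fin n ⊕ Fin n) (j : Fin n) : MvPolynomial.pderiv s (zPoly j)
    = MvPolynomial.C (Sum.elim (fun i => if i = j then 1 else 0)
      (fun i => if i = j then Complex.I else 0) s) := by
  rcases s with i | i <;>
    simp [zPoly, MvPolynomial.pderiv_X, Pi.single_apply] <;> split_ifs <;> simp_all

theorem pderiv_zbarPoly (s : Fin n ⊕ Fin n) (j : Fin n) : MvPolynomial.pderiv s (zbarPoly j)
    = MvPolynomial.C (Sum.elim (fun i => if i = j then 1 else 0)
      (fun i => if i = j then -Complex.I else 0) s) := by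
  rcases s with i | i <;>
    simp [zbarPoly, MvPolynomial.pderiv_X, Pi.single_apply] <;> split_ifs <;> simp_all

theorem sum_pderiv_zPoly_mul_zbarPoly (j k : Fin n) :
    ∑ s, MvPolynomial.pderiv s (MvPolynomial.pderiv s (zPoly j * zbarPoly k))
      = MvPolynomial.C (if j = k then 4 else 0) := by
  simp only [Derivation.leibniz, pderiv_zPoly, pderiv_zbarPoly, map_add, smul_eq_mul,
    MvPolynomial.pderiv_C, mul_zero, zero_add, ← map_mul]
  simp only [← map_add]
  rw [← map_sum]
  congr 1
  rw [Fintype.sum_sum_type]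
  rcases eq_or_ne j k with rfl | h
  · simp [Finset.sum_add_distrib]
    norm_num
  · have h' : ∀ x, ¬(x = j ∧ x = k) := fun x hx => h (hx.1.symm.trans hx.2)
    simp [h, h.symm, ← ite_and, and_comm, h']

theorem restrictPoly_inl_mem_harm (j : Fin n) :
    ⇑(restrictPoly n (MvPolynomial.X (Sum.inl j))) ∈ harm n 1 0 := by
  refine ⟨zPoly j, ?_, fun w z => ?_, fun u => ?_⟩
  · simp [IsHarmonicPoly, pderiv_zPoly]
  · simp [polyVal_zPoly]
  · simp [polyVal_zPoly, restrictPoly_apply]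

theorem restrictPoly_inr_mem_harm (j : Fin n) :
    ⇑(restrictPoly n (MvPolynomial.X (Sum.inr j))) ∈ harm n 0 1 := by
  refine ⟨zbarPoly j, ?_, fun w z => ?_, fun u => ?_⟩
  · simp [IsHarmonicPoly, pderiv_zbarPoly]
  · simp [polyVal_zbarPoly]
  · simp [polyVal_zbarPoly, restrictPoly_apply]

theorem one_mem_harm : ⇑(1 : C(Sph n, ℂ)) ∈ harm n 0 0 :=
  ⟨1, by simp [IsHarmonicPoly], fun w z => by simp [polyVal], fun u => by simp [polyVal]⟩

/-- The function `z_j z̄_k - δ_{jk} / n` on the sphere, the harmonic part of `z_j z̄_k`. -/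
def tracelessForm (n : ℕ) (p : Fin n × Fin n) : C(Sph n, ℂ) :=
  restrictPoly n (MvPolynomial.X (Sum.inl p.1) * MvPolynomial.X (Sum.inr p.2))
    - (if p.1 = p.2 then (n : ℂ)⁻¹ else 0) • 1

theorem tracelessForm_mem_harm [NeZero n] (p : Fin n × Fin n) :
    ⇑(tracelessForm n p) ∈ harm n 1 1 := by
  have hn : (n : ℂ) ≠ 0 := by exact_mod_cast NeZero.ne n
  obtain ⟨j, k⟩ := p
  set c : ℂ := if j = k then (n : ℂ)⁻¹ else 0 with hc
  have hv : ∀ z : Cn n, polyVal (zPoly j * zbarPoly k - c • ∑ i, zPoly i * zbarPoly i) z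
      = z j * conj (z k) - c * ∑ i, z i * conj (z i) := by
    intro z
    have h1 := fun i => polyVal_zPoly i z
    have h2 := fun i => polyVal_zbarPoly i z
    simp only [polyVal] at h1 h2 ⊢
    simp only [map_sub, map_mul, MvPolynomial.smul_eval, map_sum, h1, h2]
  refine ⟨zPoly j * zbarPoly k - c • ∑ i, zPoly i * zbarPoly i, ?_, fun w z => ?_, fun u => ?_⟩
  · rw [IsHarmonicPoly]
    simp only [map_sub, Derivation.map_smul, map_sum, Finset.sum_sub_distrib, ← Finset.smul_sum]
    rw [Finset.sum_comm]
    simp only [sum_pderiv_zPoly_mul_zbarPoly]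
    rw [← map_sum, MvPolynomial.smul_eq_C_mul, ← map_mul, ← map_sub, hc]
    split_ifs with h <;> simp [hn]
  · rw [hv, hv]
    simp only [PiLp.smul_apply, smul_eq_mul, map_mul, pow_one, mul_sub, Finset.mul_sum]
    congr 1
    · ring
    · exact Finset.sum_congr rfl fun i _ => by ring
  · rw [hv]
    have : ∑ i, (u : Cn n) i * conj ((u : Cn n) i) = 1 := by
      simp only [Complex.mul_conj']
      have := EuclideanSpace.norm_sq_eq (u : Cn n)
      rw [norm_eq_of_mem_sphere, one_pow] at this
      exact_mod_cast this.symm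
    rw [this]
    simp only [tracelessForm, ContinuousMap.sub_apply, ContinuousMap.smul_apply,
      restrictPoly_apply, hc]
    simp

theorem star_tracelessForm (p : Fin n × Fin n) :
    star (tracelessForm n p) = tracelessForm n p.swap := by
  obtain ⟨j, k⟩ := p
  ext u
  simp only [tracelessForm, ContinuousMap.star_apply, ContinuousMap.sub_apply,
    ContinuousMap.smul_apply, restrictPoly_apply, Prod.swap, eq_comm (a := k)]
  split_ifs <;> simp [mul_comm]

/-- Spherical harmonics of bidegree `(k, l)` are eigenvectors of `f ↦ f ∘ J`, as `J` is the rotation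
by `π / 2`. -/
theorem harm_le_eigenspace (k l : ℕ) : harm n k l ≤
    Module.End.eigenspace (LinearMap.funLeft ℂ ℂ (rot (n := n) (Real.pi / 2)))
      (Complex.I ^ k * (-Complex.I) ^ l) := by
  rintro f ⟨P, -, hb, hf⟩
  rw [Module.End.mem_eigenspace_iff]
  ext u
  rw [LinearMap.funLeft_apply, hf]
  simp only [rot]
  rw [hb]
  simp [Complex.exp_pi_div_two_mul_I, hf]

/-- The three spaces lie in the eigenspaces of `f ↦ f ∘ J` for `i`, `-i` and `1`. -/
theorem iSupIndep_harm : iSupIndep ![harm n 1 0, harm n 0 1, harm n 1 1] := by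
  have hinj : Function.Injective ![Complex.I, -Complex.I, (1 : ℂ)] := by
    intro i j
    fin_cases i <;> fin_cases j <;> simp [Complex.ext_iff] <;> norm_num
  refine ((Module.End.eigenspaces_iSupIndep
    (LinearMap.funLeft ℂ ℂ (rot (n := n) (Real.pi / 2)))).comp hinj).mono fun i => ?_
  fin_cases i
  · simpa using harm_le_eigenspace (n := n) 1 0
  · simpa using harm_le_eigenspace (n := n) 0 1
  · simpa using harm_le_eigenspace (n := n) 1 1

theorem linearFunctionals_eq_span : linearFunctionals n = (Submodule.span ℂ
    (Set.range fun s => ⇑(restrictPoly n (MvPolynomial.X s))) : Set (Sph n → ℂ)) := by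
  ext f
  constructor
  · rintro ⟨L, hL⟩
    have hz : ∀ z : Cn n, z = ∑ j, ((z j).re • EuclideanSpace.single j (1 : ℂ)
        + (z j).im • EuclideanSpace.single j Complex.I) := by
      intro z
      ext k
      simp [Finset.sum_add_distrib, Pi.single_apply, Complex.re_add_im]
    have hf : f = ∑ j, (((L (EuclideanSpace.single j 1) - Complex.I
            * L (EuclideanSpace.single j Complex.I)) / 2)
          • ⇑(restrictPoly n (MvPolynomial.X (Sum.inl j)))
        + ((L (EuclideanSpace.single j 1) + Complex.I * L (EuclideanSpace.single j Complex.I)) / 2)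
          • ⇑(restrictPoly n (MvPolynomial.X (Sum.inr j)))) := by
      ext u
      conv_lhs => rw [hL, hz u, map_sum]
      rw [Finset.sum_apply]
      refine Finset.sum_congr rfl fun j _ => ?_
      simp only [map_add, map_smul, Complex.real_smul, Pi.add_apply, Pi.smul_apply, smul_eq_mul,
        restrictPoly_apply, MvPolynomial.eval_X, zCoord_inl, zCoord_inr]
      rw [Complex.re_eq_add_conj, Complex.im_eq_sub_conj]
      field_simp
      ring_nf
      simp
      ring
    rw [hf]
    exact Submodule.sum_mem _ fun j _ => add_mem
      (Submodule.smul_mem _ _ (Submodule.subset_span ⟨_, rfl⟩))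
      (Submodule.smul_mem _ _ (Submodule.subset_span ⟨_, rfl⟩))
  · intro hf
    induction hf using Submodule.span_induction with
    | mem x hx =>
      obtain ⟨s, rfl⟩ := hx
      exact ⟨zCoord n s, fun u => by simp [restrictPoly_apply]⟩
    | zero => exact ⟨0, fun u => by simp⟩
    | add x y _ _ hx hy =>
      obtain ⟨L, hL⟩ := hx
      obtain ⟨M, hM⟩ := hy
      exact ⟨L + M, fun u => by simp [hL, hM]⟩
    | smul c x _ hx =>
      obtain ⟨L, hL⟩ := hx
      exact ⟨c • L, fun u => by simp [hL]⟩

/-! ### The spectrum -/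

theorem ballVol_pos (m : ℕ) : 0 < ballVol m :=
  ENNReal.toReal_pos (Metric.measure_ball_pos volume _ one_pos).ne' measure_ball_lt_top.ne

section
variable {α β γ : ℝ}

theorem bidegreeEigenvalue_zero_zero : bidegreeEigenvalue n α β γ 0 0 = γ := by
  simp [bidegreeEigenvalue]

theorem bidegreeEigenvalue_one_zero (hγ : γ = α + (2 * n - 1) * β) :
    bidegreeEigenvalue n α β γ 1 0 = 0 := by
  simp [bidegreeEigenvalue, hγ]
  ring

theorem bidegreeEigenvalue_zero_one (hγ : γ = α + (2 * n - 1) * β) :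
    bidegreeEigenvalue n α β γ 0 1 = 0 := by
  simp [bidegreeEigenvalue, hγ]
  ring

theorem bidegreeEigenvalue_one_one : bidegreeEigenvalue n α β γ 1 1 = γ - 4 * n * β := by
  simp [bidegreeEigenvalue]
  ring

theorem bidegreeEigenvalue_neg (hn : 2 ≤ n) (hβ : 0 < β) (hαβ : 0 ≤ α + β) (hγ : γ = α +
    (2 * n - 1) * β)
    (h : γ < 4 * n * β) {k l : ℕ} (hkl : 2 ≤ k + l) : bidegreeEigenvalue n α β γ k l < 0 := by
  have hn' : (2 : ℝ) ≤ n := by exact_mod_cast hn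
  have hm : (2 : ℝ) ≤ k + l := by exact_mod_cast hkl
  have hk : (0 : ℝ) ≤ k * l := by positivity
  rw [bidegreeEigenvalue]
  set m : ℝ := k + l with hmdef
  have hd : ((k : ℝ) - l) ^ 2 ≤ m ^ 2 := by rw [hmdef]; nlinarith
  rcases le_or_gt 0 α with hα | hα
  · have h1 : 0 ≤ α * ((k : ℝ) - l) ^ 2 := by positivity
    have h2 : 4 * n ≤ m * (m + 2 * n - 2) := by nlinarith
    nlinarith [mul_le_mul_of_nonneg_left h2 hβ.le]
  · have h1 : α * m ^ 2 ≤ α * ((k : ℝ) - l) ^ 2 := mul_le_mul_of_nonpos_left hd hα.le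
    have h2 : 0 ≤ (α + β) * (m ^ 2 - 1) := mul_nonneg hαβ (by nlinarith)
    have h3 : 0 < β * ((2 * n - 2) * (m - 1)) :=
      mul_pos hβ (mul_pos (by linarith) (by linarith))
    rw [hγ]
    nlinarith

theorem bidegreeEigenvalue_neg_of_eq (hn : 2 ≤ n) (hα : 0 < α) (hβ : 0 < β) (h : γ = 4 * n * β)
    {k l : ℕ}
    (hkl : 2 ≤ k + l) (hne : ¬(k = 1 ∧ l = 1)) : bidegreeEigenvalue n α β γ k l < 0 := by
  have hn' : (2 : ℝ) ≤ n := by exact_mod_cast hn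
  rw [bidegreeEigenvalue, h]
  rcases eq_or_ne k l with rfl | hd
  · have hm : (4 : ℝ) ≤ k + k := by
      have : 4 ≤ k + k := by omega
      exact_mod_cast this
    have h2 : 4 * n < ((k : ℝ) + k) * (k + k + 2 * n - 2) := by nlinarith
    nlinarith [mul_lt_mul_of_pos_left h2 hβ]
  · have hm : (2 : ℝ) ≤ k + l := by exact_mod_cast hkl
    have h1 : 0 < α * ((k : ℝ) - l) ^ 2 :=
      mul_pos hα (sq_pos_of_ne_zero (sub_ne_zero.2 (by exact_mod_cast hd)))
    have h2 : 4 * n ≤ ((k : ℝ) + l) * (k + l + 2 * n - 2) := by nlinarith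
    nlinarith [mul_le_mul_of_nonneg_left h2 hβ.le]

variable [NeZero n] {D : (Sph n → ℝ) → Sph n → ℝ}

theorem bidegree_cases (k l : ℕ) :
    (k = 0 ∧ l = 0) ∨ (k = 1 ∧ l = 0) ∨ (k = 0 ∧ l = 1) ∨ 2 ≤ k + l := by omega

/-- The common form of the two cases with strict inequality. -/
theorem onePositiveEigenvalue_and_kernel
    (hD : ∀ f u, D f u = α * JN (JN f) u + β * sphLaplacian f u + γ * f u) (hn : 2 ≤ n)
    (hαβ : 0 ≤ α + β) (hγ : γ = α + (2 * n - 1) * β) (h : γ < 4 * n * β) :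
    OnePositiveEigenvalue (complexify D) ∧
      eigenfunctions (complexify D) 0 = linearFunctionals n := by
  have hn' : (2 : ℝ) ≤ n := by exact_mod_cast hn
  have hβ : 0 < β := by nlinarith
  have hγ0 : 0 < γ := by nlinarith [mul_pos (by linarith : (0 : ℝ) < n - 1) hβ]
  have hneg : ∀ {k l : ℕ}, 2 ≤ k + l → bidegreeEigenvalue n α β γ k l < 0 := bidegreeEigenvalue_neg
    hn hβ hαβ hγ h
  refine ⟨⟨γ, hγ0, ?_, fun s hs => ⟨?_, ?_⟩⟩, ?_⟩
  · have h0 := eigenfunctions_eq_span hD γ (fun _ : Unit => 1) (fun _ => ?_) (fun _ => ?_) ?_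
    · rw [h0]
      ext f
      rw [Set.range_const, SetLike.mem_coe, Submodule.mem_span_singleton]
      constructor
      · rintro ⟨z, rfl⟩
        exact ⟨z, fun u => by simp⟩
      · rintro ⟨z, hz⟩
        exact ⟨z, by ext u; simp [hz]⟩
    · rw [star_one]
      exact Submodule.subset_span (Set.mem_range_self ())
    · simpa [bidegreeEigenvalue_zero_zero] using harm_le_eigenSubmodule hD 0 0 one_mem_harm
    · intro f _ hf e he
      rcases bidegree_cases (holDegree e) (antiholDegree e) with ⟨h1, h2⟩ | ⟨h1, h2⟩ | ⟨h1, h2⟩ | h1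
      · rw [restrictPoly_monomial_zero_zero h1 h2]
        exact hf ()
      · rw [h1, h2, bidegreeEigenvalue_one_zero hγ] at he
        exact absurd he hγ0.ne
      · rw [h1, h2, bidegreeEigenvalue_zero_one hγ] at he
        exact absurd he hγ0.ne
      · exact absurd he ((hneg h1).trans hγ0).ne
  · rintro ⟨f, hf, hf0⟩
    by_contra hsγ
    have := eigenfunctions_eq_span hD s (fun i : Empty => i.elim) (fun i => i.elim)
      (fun i => i.elim) (fun f _ _ e he => by
        rcases bidegree_cases (holDegree e) (antiholDegree e) with ⟨h1, h2⟩ | ⟨h1, h2⟩ |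
          ⟨h1, h2⟩ | h1
        · rw [h1, h2, bidegreeEigenvalue_zero_zero] at he
          exact absurd he.symm hsγ
        · rw [h1, h2, bidegreeEigenvalue_one_zero hγ] at he
          exact absurd he hs.ne
        · rw [h1, h2, bidegreeEigenvalue_zero_one hγ] at he
          exact absurd he hs.ne
        · exact absurd he ((hneg h1).trans hs).ne)
    rw [this, Set.range_eq_empty, Submodule.span_empty] at hf
    exact hf0 hf
  · rintro rfl
    have h1 := harm_le_eigenSubmodule hD 0 0 one_mem_harm
    rw [bidegreeEigenvalue_zero_zero] at h1
    refine ⟨_, h1, fun h0 => ?_⟩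
    have := congrFun h0 ⟨EuclideanSpace.single 0 1, by simp⟩
    simp at this
  · have h0 := eigenfunctions_eq_span hD 0 (fun s => restrictPoly n (MvPolynomial.X s))
      (fun s => ?_) (fun s => ?_) ?_
    · rw [linearFunctionals_eq_span, ← h0, Complex.ofReal_zero]
    · rw [star_restrictPoly_X]
      exact Submodule.subset_span (Set.mem_range_self s.swap)
    · rcases s with j | j
      · simpa [bidegreeEigenvalue_one_zero hγ] using
          harm_le_eigenSubmodule hD 1 0 (restrictPoly_inl_mem_harm j)
      · simpa [bidegreeEigenvalue_zero_one hγ] using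
          harm_le_eigenSubmodule hD 0 1 (restrictPoly_inr_mem_harm j)
    · intro f _ hf e he
      rcases bidegree_cases (holDegree e) (antiholDegree e) with ⟨h1, h2⟩ | ⟨h1, h2⟩ | ⟨h1, h2⟩ | h1
      · rw [h1, h2, bidegreeEigenvalue_zero_zero] at he
        exact absurd he hγ0.ne'
      · obtain ⟨j, hj⟩ := restrictPoly_monomial_one_zero h1 h2
        rw [hj, hf]
      · obtain ⟨j, hj⟩ := restrictPoly_monomial_zero_one h1 h2
        rw [hj, hf]
      · exact absurd he (hneg h1).ne

/-- The boundary case `γ = 4nβ`, in which the bidegree `(1, 1)` contributes to the kernel. -/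
theorem kernel_eq_harm
    (hD : ∀ f u, D f u = α * JN (JN f) u + β * sphLaplacian f u + γ * f u) (hn : 2 ≤ n)
    (hα : 0 < α) (hβ : 0 < β) (hγ : γ = α + (2 * n - 1) * β) (h : γ = 4 * n * β) :
    eigenfunctions (complexify D) 0
      = ((harm n 1 0 ⊔ harm n 0 1 ⊔ harm n 1 1 : Submodule ℂ (Sph n → ℂ)) : Set (Sph n → ℂ)) := by
  have hn' : (2 : ℝ) ≤ n := by exact_mod_cast hn
  have hγ0 : 0 < γ := by rw [h]; positivity
  have hle : harm n 1 0 ⊔ harm n 0 1 ⊔ harm n 1 1 ≤ eigenSubmodule hD 0 := by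
    refine sup_le (sup_le ?_ ?_) ?_
    · simpa [bidegreeEigenvalue_one_zero hγ] using harm_le_eigenSubmodule hD 1 0
    · simpa [bidegreeEigenvalue_zero_one hγ] using harm_le_eigenSubmodule hD 0 1
    · simpa [bidegreeEigenvalue_one_one, h] using harm_le_eigenSubmodule hD 1 1
  let g : (Fin n ⊕ Fin n) ⊕ (Fin n × Fin n) → C(Sph n, ℂ) :=
    Sum.elim (fun s => restrictPoly n (MvPolynomial.X s)) (tracelessForm n)
  have hg : ∀ i, ⇑(g i) ∈ harm n 1 0 ⊔ harm n 0 1 ⊔ harm n 1 1 := by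
    rintro ((j | j) | p)
    · exact Submodule.mem_sup_left (Submodule.mem_sup_left (restrictPoly_inl_mem_harm j))
    · exact Submodule.mem_sup_left (Submodule.mem_sup_right (restrictPoly_inr_mem_harm j))
    · exact Submodule.mem_sup_right (tracelessForm_mem_harm p)
  have h0 := eigenfunctions_eq_span hD 0 g (fun i => ?_) (fun i => hle (hg i)) ?_
  · rw [Complex.ofReal_zero] at h0
    refine Set.Subset.antisymm ?_ (fun f hf => by simpa [eigenSubmodule] using hle hf)
    rw [h0]
    exact Submodule.span_le.2 (Set.range_subset_iff.2 hg)
  · rcases i with s | p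
    · exact Submodule.subset_span ⟨Sum.inl s.swap, (star_restrictPoly_X s).symm⟩
    · exact Submodule.subset_span ⟨Sum.inr p.swap, (star_tracelessForm p).symm⟩
  · intro f hf hort e he
    rcases bidegree_cases (holDegree e) (antiholDegree e) with ⟨h1, h2⟩ | ⟨h1, h2⟩ | ⟨h1, h2⟩ | h1
    · rw [h1, h2, bidegreeEigenvalue_zero_zero] at he
      exact absurd he hγ0.ne'
    · obtain ⟨j, hj⟩ := restrictPoly_monomial_one_zero h1 h2
      rw [hj]
      exact hort (Sum.inl (Sum.inl j))
    · obtain ⟨j, hj⟩ := restrictPoly_monomial_zero_one h1 h2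
      rw [hj]
      exact hort (Sum.inl (Sum.inr j))
    · by_cases h11 : holDegree e = 1 ∧ antiholDegree e = 1
      · obtain ⟨j, k, hjk⟩ := restrictPoly_monomial_one_one h11.1 h11.2
        -- Constants are eigenfunctions for `γ ≠ 0`, so `f` is orthogonal to them, and
        -- `z_j z̄_k` may be replaced by its traceless part.
        have hone : sphIntegral n (f * 1) = 0 := by
          have h2 := hf 0
          have h3 : restrictPoly n (MvPolynomial.monomial 0 1) = 1 := map_one _
          have h4 : polyLaplacian (MvPolynomial.monomial (0 : (Fin n ⊕ Fin n) →₀ ℕ) 1) = 0 := by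
            simp [polyLaplacian]
          have h5 : bidegreeEigenvalue n α β γ (holDegree (0 : (Fin n ⊕ Fin n) →₀ ℕ))
            (antiholDegree (0 : (Fin n ⊕ Fin n) →₀ ℕ))
              = γ := by
            simp [holDegree, antiholDegree, bidegreeEigenvalue_zero_zero]
          rw [h3, h4, h5, map_zero, mul_zero, map_zero, mul_zero] at h2
          refine (mul_eq_zero.1 h2).resolve_left ?_
          exact_mod_cast (by linarith : 0 - γ < 0).ne
        have h6 := hort (Sum.inr (j, k))
        simp only [g, Sum.elim_inr, tracelessForm] at h6
        rw [mul_sub, map_sub, mul_smul_comm, map_smul, hone, smul_zero, sub_zero] at h6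
        rw [hjk, h6]
      · exact absurd he (bidegreeEigenvalue_neg_of_eq hn hα hβ h h1 h11).ne
end

theorem opTwo_eq (c₀ c₁ : ℝ) (f : Sph n → ℝ) (u : Sph n) : opTwo n c₀ c₁ f u
    = (1 / ballVol (2 * n - 2) * (2 * n * (c₁ - c₀))) * JN (JN f) u
      + (1 / ballVol (2 * n - 2) * (2 * c₀ - c₁)) * sphLaplacian f u
      + (1 / ballVol (2 * n - 2) * (2 * ((n : ℝ) - 1) * c₀ + c₁)) * f u := by
  rw [opTwo]
  ring

theorem opThreeBall_eq (c₀ c₁ : ℝ) (f : Sph n → ℝ) (u : Sph n) : opThreeBall n c₀ c₁ f u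
    = (1 / ballVol (2 * n - 3) * (coeffA n c₀ c₁ - coeffB n c₀ c₁)) * JN (JN f) u
      + (1 / ballVol (2 * n - 3) * coeffB n c₀ c₁) * sphLaplacian f u
      + (1 / ballVol (2 * n - 3) * (coeffA n c₀ c₁ + 2 * ((n : ℝ) - 1) * coeffB n c₀ c₁))
        * f u := by
  rw [opThreeBall]
  ring

end

theorem mainTheorem6 (n : ℕ) [NeZero n] (hn : 2 ≤ n) (c₀ c₁ : ℝ) :
    (2 * ((n : ℝ) - 1) * c₀ ≤ (2 * (n : ℝ) - 1) * c₁ →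
      (4 * (n : ℝ) + 1) * c₁ < 2 * (3 * (n : ℝ) + 1) * c₀ →
        UnitaryVal.OnePositiveEigenvalue (UnitaryVal.complexify (UnitaryVal.opTwo n c₀ c₁)) ∧
        UnitaryVal.eigenfunctions (UnitaryVal.complexify (UnitaryVal.opTwo n c₀ c₁)) 0
          = UnitaryVal.linearFunctionals n) ∧
    (3 ≤ n →
      2 * ((n : ℝ) - 2) * c₀ ≤ (2 * (n : ℝ) - 3) * c₁ →
      (4 * (n : ℝ) ^ 2 - 9 * (n : ℝ) - 3) * c₁ < 2 * (3 * (n : ℝ) ^ 2 - 5 * (n : ℝ) - 2) * c₀ →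
        UnitaryVal.OnePositiveEigenvalue
          (UnitaryVal.complexify (UnitaryVal.opThreeBall n c₀ c₁)) ∧
        UnitaryVal.eigenfunctions (UnitaryVal.complexify (UnitaryVal.opThreeBall n c₀ c₁)) 0
          = UnitaryVal.linearFunctionals n) ∧
    (0 < (4 * (n : ℝ) + 1) * c₁ →
      (4 * (n : ℝ) + 1) * c₁ = 2 * (3 * (n : ℝ) + 1) * c₀ →
        iSupIndep ![UnitaryVal.harm n 1 0, UnitaryVal.harm n 0 1, UnitaryVal.harm n 1 1] ∧
        UnitaryVal.eigenfunctions (UnitaryVal.complexify (UnitaryVal.opTwo n c₀ c₁)) 0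
          = ((UnitaryVal.harm n 1 0 ⊔ UnitaryVal.harm n 0 1 ⊔ UnitaryVal.harm n 1 1 :
              Submodule ℂ (UnitaryVal.Sph n → ℂ)) : Set (UnitaryVal.Sph n → ℂ))) := by
  have hn' : (2 : ℝ) ≤ n := by exact_mod_cast hn
  have hκ : ∀ m, 0 < 1 / UnitaryVal.ballVol m := fun m => one_div_pos.2 (ballVol_pos m)
  have hD2 := opTwo_eq (n := n) c₀ c₁
  have hD3 := opThreeBall_eq (n := n) c₀ c₁
  have h2 := hκ (2 * n - 2)
  have h3 := hκ (2 * n - 3)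
  generalize 1 / UnitaryVal.ballVol (2 * n - 2) = κ at hD2 h2
  generalize 1 / UnitaryVal.ballVol (2 * n - 3) = κ' at hD3 h3
  -- In the first two parts the hypotheses are `0 ≤ α + β` and `γ < 4nβ`, up to positive factors.
  refine ⟨fun ha hb => ?_, fun hn3 ha hb => ?_, fun ha hb => ⟨iSupIndep_harm, ?_⟩⟩
  · refine onePositiveEigenvalue_and_kernel hD2 hn ?_ (by ring) ?_
    · rw [← mul_add]
      exact mul_nonneg h2.le (by linarith)
    · rw [mul_left_comm]
      exact mul_lt_mul_of_pos_left (by linarith) h2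
  · refine onePositiveEigenvalue_and_kernel hD3 hn ?_ (by ring) ?_
    · rw [← mul_add, UnitaryVal.coeffA]
      exact mul_nonneg h3.le (by nlinarith)
    · rw [mul_left_comm]
      exact mul_lt_mul_of_pos_left (by rw [UnitaryVal.coeffA, UnitaryVal.coeffB]; nlinarith) h3
  · have hc₁ : 0 < c₁ := pos_of_mul_pos_right ha (by linarith)
    -- Positivity of `α` and `β` after multiplication by `3n + 1`.
    have hc : 2 * n * (c₁ - c₀) * (3 * n + 1) = n * (2 * n + 1) * c₁ := by linear_combination n * hb
    have hc' : (2 * c₀ - c₁) * (3 * n + 1) = n * c₁ := by linear_combination -hb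
    refine kernel_eq_harm hD2 hn (mul_pos h2 ?_) (mul_pos h2 ?_) (by ring) ?_
    · refine pos_of_mul_pos_left (b := 3 * (n : ℝ) + 1) ?_ (by positivity)
      rw [hc]
      positivity
    · refine pos_of_mul_pos_left (b := 3 * (n : ℝ) + 1) ?_ (by positivity)
      rw [hc']
      positivity
    · linear_combination κ * hb
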